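/- A linear quantum cellular automaton (LQCA) is a tuple $A=(\Sigma,q,N,\delta)$, where $\Sigma$ is a finite set of states with a distinguished (quiescent) state $q\in\Sigma$, $N=(a_1<\dots<a_r)$ with $r\ge 1$ is a strictly increasing sequence of integers (not necessarily consecutive), and $\delta:\Sigma^r\to\mathbb C^\Sigma$ satisfies $\|\delta(w)\|>0$ for all $w$, $[\delta(q,\dots,q)](q)=1$ and $[\delta(q,\dots,q)](x)=0$ for $x\ne q$. Its configurations are the maps $c:\mathbb Z\to\Sigma$ with $c_i=q$ for all but finitely many $i$; let $\mathcal C_A$ be the set of configurations. Its time evolution operator has the matrix $U_A(d,c)=\prod_{i\in\mathbb Z}[\delta(c_{i+a_1},\dots,c_{i+a_r})](d_i)$ for $c,d\in\mathcal C_A$, and $A$ is well-formed if $U_A$ preserves the norm of $\ell_2(\mathcal C_A)$. The size of $A$ is $n=|\Sigma|^{r+1}$, its span is $s=a_r-a_1+1$, and its expansion factor is $e=(s+1)/(r+1)$. In the algebraic model of computation (a random access machine whose memory cells hold integers and complex numbers, and in which arithmetic operations, including complex conjugation, and comparisons take unit time), there is an algorithm which takes an arbitrary LQCA $A$ as input (its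 states being numbered in any way, $\delta$ given by a table) and decides whether $A$ is well-formed. The complexity of the algorithm is $O(n^{2e})$: there is an absolute constant $C$ such that on every LQCA of size $n$ with expansion factor $e$ it halts within time $C\,n^{2e}$. -/

import Mathlib

/-! ### Linear quantum cellular automata -/

/-- A linear quantum cellular automaton with finite state set `Q`: a quiescent state `q`, a
neighborhood `nbr 0 < nbr 1 < ⋯ < nbr (r - 1)` of signed integers with `r ≥ 1`, and a local
transition function `δ` with values in the Hermitian space `ℂ^Q` that vanishes nowhere and maps
`(q, …, q)` to the basis vector of `q`. -/
structure LQCA (Q : Type*) [Fintype Q] where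
  q : Q
  r : ℕ
  one_le_r : 1 ≤ r
  nbr : Fin r → ℤ
  nbr_strictMono : StrictMono nbr
  δ : (Fin r → Q) → EuclideanSpace ℂ Q
  δ_norm_pos : ∀ w, 0 < ‖δ w‖
  δ_quiescent_self : δ (fun _ => q) q = 1
  δ_quiescent_ne : ∀ x, x ≠ q → δ (fun _ => q) x = 0

namespace LQCA

variable {Q : Type*} [Fintype Q] (A : LQCA Q)

/-- (Finite) configurations: all but finitely many cells are quiescent. -/
def Config : Type _ := {c : ℤ → Q // {i : ℤ | c i ≠ A.q}.Finite}

/-- The time evolution matrix: `U d c` is the amplitude with which `d` is entered from `c` in one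
step. All but finitely many factors are equal to `1`. -/
noncomputable def U (d c : A.Config) : ℂ :=
  ∏ᶠ i : ℤ, A.δ (fun j => c.1 (i + A.nbr j)) (d.1 i)

/-- The automaton is well-formed if its time evolution operator preserves the norm of `ℓ²` of the
set of configurations: each `u` in `ℓ²` is mapped to a `v` in `ℓ²`, given by
`v d = ∑ c, U d c * u c`, that has the same norm. -/
def WellFormed : Prop :=
  ∀ u : lp (fun _ : A.Config => ℂ) 2, ∃ v : lp (fun _ : A.Config => ℂ) 2,
    (∀ d, HasSum (fun c => A.U d c * u c) (v d)) ∧ ‖v‖ = ‖u‖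

/-- The size `n = |Q| ^ (r + 1)`, the number of entries of the table of `δ`. -/
def size : ℕ := Fintype.card Q ^ (A.r + 1)

/-- The span `s = a_r - a_1 + 1` of the neighborhood `(a_1, …, a_r)`. -/
def span : ℤ :=
  A.nbr ⟨A.r - 1, Nat.sub_lt A.one_le_r Nat.one_pos⟩ - A.nbr ⟨0, A.one_le_r⟩ + 1

/-- The expansion factor `e = (s + 1) / (r + 1)`. -/
noncomputable def expansion : ℝ := ((A.span : ℝ) + 1) / ((A.r : ℝ) + 1)

end LQCA

/-! ### The algebraic model of computation

A random access machine over the complex numbers, with structured programs. Integers (for counting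
and addressing) and complex numbers each occupy one cell; every arithmetic operation, comparison,
memory access and assignment takes one unit of time. A program mentions only finitely many
registers and arrays, and its only constants are integers. -/

namespace AlgRAM

/-- Memory: integer and complex registers, integer and complex arrays. -/
structure State where
  ireg : ℕ → ℤ
  iarr : ℕ → ℤ → ℤ
  creg : ℕ → ℂ
  carr : ℕ → ℤ → ℂ

/-- Integer expressions; `load a e` is the entry at address `e` of the integer array `a`. -/
inductive IExpr : Type
  | const (z : ℤ)
  | reg (x : ℕ)
  | load (a : ℕ) (e : IExpr)
  | add (e f : IExpr)
  | sub (e f : IExpr)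
  | mul (e f : IExpr)

/-- Complex expressions; `load a e` is the entry at address `e` of the complex array `a`. -/
inductive CExpr : Type
  | const (z : ℤ)
  | reg (x : ℕ)
  | load (a : ℕ) (e : IExpr)
  | add (e f : CExpr)
  | sub (e f : CExpr)
  | mul (e f : CExpr)
  | div (e f : CExpr)
  | conj (e : CExpr)

/-- Comparisons: equality and order of integers, equality of complex numbers, order of real numbers
(of the real parts, if the numbers are not real). -/
inductive Cond : Type
  | ieq (e f : IExpr)
  | ile (e f : IExpr)
  | ceq (e f : CExpr)
  | cle (e f : CExpr)

/-- Programs. -/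
inductive Prog : Type
  | skip
  | setI (x : ℕ) (e : IExpr)
  | setC (x : ℕ) (e : CExpr)
  | storeI (a : ℕ) (i e : IExpr)
  | storeC (a : ℕ) (i : IExpr) (e : CExpr)
  | seq (p p' : Prog)
  | ite (b : Cond) (p p' : Prog)
  | while (b : Cond) (p : Prog)

/-- The value of an integer expression. -/
def IExpr.val (σ : State) : IExpr → ℤ
  | const z => z
  | reg x => σ.ireg x
  | load a e => σ.iarr a (e.val σ)
  | add e f => e.val σ + f.val σ
  | sub e f => e.val σ - f.val σ
  | mul e f => e.val σ * f.val σ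

/-- The time to evaluate an integer expression. -/
def IExpr.cost : IExpr → ℕ
  | const _ => 1
  | reg _ => 1
  | load _ e => e.cost + 1
  | add e f => e.cost + f.cost + 1
  | sub e f => e.cost + f.cost + 1
  | mul e f => e.cost + f.cost + 1

/-- The value of a complex expression (a quotient with denominator `0` has the value `0`). -/
noncomputable def CExpr.val (σ : State) : CExpr → ℂ
  | const z => (z : ℂ)
  | reg x => σ.creg x
  | load a e => σ.carr a (e.val σ)
  | add e f => e.val σ + f.val σ
  | sub e f => e.val σ - f.val σ
  | mul e f => e.val σ * f.val σ
  | div e f => e.val σ / f.val σ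
  | conj e => star (e.val σ)

/-- The time to evaluate a complex expression. -/
def CExpr.cost : CExpr → ℕ
  | const _ => 1
  | reg _ => 1
  | load _ e => e.cost + 1
  | add e f => e.cost + f.cost + 1
  | sub e f => e.cost + f.cost + 1
  | mul e f => e.cost + f.cost + 1
  | div e f => e.cost + f.cost + 1
  | conj e => e.cost + 1

/-- The truth of a comparison. -/
def Cond.Holds (σ : State) : Cond → Prop
  | ieq e f => e.val σ = f.val σ
  | ile e f => e.val σ ≤ f.val σ
  | ceq e f => e.val σ = f.val σ
  | cle e f => (e.val σ).re ≤ (f.val σ).re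

/-- The time of a comparison. -/
def Cond.cost : Cond → ℕ
  | ieq e f => e.cost + f.cost + 1
  | ile e f => e.cost + f.cost + 1
  | ceq e f => e.cost + f.cost + 1
  | cle e f => e.cost + f.cost + 1

/-- Write to an integer register. -/
def State.setI (σ : State) (x : ℕ) (v : ℤ) : State :=
  { σ with ireg := Function.update σ.ireg x v }

/-- Write to a complex register. -/
def State.setC (σ : State) (x : ℕ) (v : ℂ) : State :=
  { σ with creg := Function.update σ.creg x v }

/-- Write to a cell of an integer array. -/
def State.storeI (σ : State) (a : ℕ) (i v : ℤ) : State :=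
  { σ with iarr := Function.update σ.iarr a (Function.update (σ.iarr a) i v) }

/-- Write to a cell of a complex array. -/
def State.storeC (σ : State) (a : ℕ) (i : ℤ) (v : ℂ) : State :=
  { σ with carr := Function.update σ.carr a (Function.update (σ.carr a) i v) }

/-- `Runs p σ t σ'`: started in `σ`, the program `p` halts after `t` units of time in `σ'`. -/
inductive Runs : Prog → State → ℕ → State → Prop
  | skip (σ : State) : Runs .skip σ 1 σ
  | setI (σ : State) (x : ℕ) (e : IExpr) :
      Runs (.setI x e) σ (e.cost + 1) (σ.setI x (e.val σ))
  | setC (σ : State) (x : ℕ) (e : CExpr) :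
      Runs (.setC x e) σ (e.cost + 1) (σ.setC x (e.val σ))
  | storeI (σ : State) (a : ℕ) (i e : IExpr) :
      Runs (.storeI a i e) σ (i.cost + e.cost + 1) (σ.storeI a (i.val σ) (e.val σ))
  | storeC (σ : State) (a : ℕ) (i : IExpr) (e : CExpr) :
      Runs (.storeC a i e) σ (i.cost + e.cost + 1) (σ.storeC a (i.val σ) (e.val σ))
  | seq {p p' : Prog} {σ₁ σ₂ σ₃ : State} {t t' : ℕ} :
      Runs p σ₁ t σ₂ → Runs p' σ₂ t' σ₃ → Runs (.seq p p') σ₁ (t + t') σ₃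
  | ite_true {b : Cond} {p p' : Prog} {σ σ' : State} {t : ℕ} :
      b.Holds σ → Runs p σ t σ' → Runs (.ite b p p') σ (b.cost + t) σ'
  | ite_false {b : Cond} {p p' : Prog} {σ σ' : State} {t : ℕ} :
      ¬ b.Holds σ → Runs p' σ t σ' → Runs (.ite b p p') σ (b.cost + t) σ'
  | while_true {b : Cond} {p : Prog} {σ₁ σ₂ σ₃ : State} {t t' : ℕ} :
      b.Holds σ₁ → Runs p σ₁ t σ₂ → Runs (.while b p) σ₂ t' σ₃ →
      Runs (.while b p) σ₁ (b.cost + t + t') σ₃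
  | while_false {b : Cond} {p : Prog} {σ : State} :
      ¬ b.Holds σ → Runs (.while b p) σ b.cost σ

end AlgRAM

/-! ### Automata as inputs -/

namespace LQCA

variable {Q : Type*} [Fintype Q] (A : LQCA Q) (ε : Q ≃ Fin (Fintype.card Q))

/-- The address in the table of `δ` of the amplitude `[δ w](y)`, the states being numbered by `ε`:
the number whose base-`|Q|` digits are, from the least significant one on, those of
`y, w 0, …, w (r - 1)`. -/
def address (w : Fin A.r → Q) (y : Q) : ℕ :=
  (∑ j : Fin A.r, (ε (w j) : ℕ) * Fintype.card Q ^ (j : ℕ)) * Fintype.card Q + (ε y : ℕ)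

/-- The description of `A` in memory, the states being numbered by `ε`: the integer registers
`1, 2, 3` hold the number of states, the size `r` of the neighborhood and the number of the
quiescent state; the integer array `0` lists the neighborhood; the complex array `0` is the table
of `δ`. All other cells hold `0`. -/
noncomputable def input : AlgRAM.State where
  ireg x :=
    if x = 1 then (Fintype.card Q : ℤ)
    else if x = 2 then (A.r : ℤ)
    else if x = 3 then ((ε A.q : ℕ) : ℤ)
    else 0
  iarr a i := if a = 0 then ∑ j : Fin A.r, if i = ((j : ℕ) : ℤ) then A.nbr j else 0 else 0
  creg _ := 0
  carr a i :=
    if a = 0 then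
      ∑ w : Fin A.r → Q, ∑ y : Q, if i = (A.address ε w y : ℤ) then A.δ w y else 0
    else 0

end LQCA

/-! ### Reasoning about programs -/

/-! Write k for the number of states, s for the span, K = k^(s-1) and M = k^s. The time evolution
preserves norms iff its columns are orthonormal (`wellFormed_iff_orthonormal`). All but finitely
many windows of two configurations c and c' are quiescent, so the inner product of their columns
factors over the cells: it is the product over i of the inner products of δ at the windows of c and
c' (`inner_column`).

A window lies in a block of s consecutive cells, coded by a number x < M. In the de Bruijn graph the
block x is an edge from x / k to x % K, and moving the block by one cell is a step of a walk. Thus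
every pair (c, c') yields a closed walk through the quiescent vertex in the graph of pairs, every
such walk comes from a pair, and the inner product is the product of the Gram entries along the walk
(`exists_walk_of_config`, `exists_config_of_walk`). The walk is diagonal iff c = c'.

Columns have norm 1 iff all closed diagonal walks have weight 1, that is, iff the diagonal weights
come from a potential; the only candidate, up to a factor, is computed along a spanning tree with
root 0 (`isPotential_iff`). Distinct columns are orthogonal iff every closed walk off the diagonal
meets a vanishing Gram entry. As δ vanishes nowhere, diagonal entries are nonzero, and the diagonal
is strongly connected. So this says that no pair of distinct words reachable along nonzero entries
has a diagonal successor (`noReturn_iff`). By strong connectivity the base point is immaterial: the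
program starts at 0, whichever state is quiescent.

The Gram matrix takes time of order M²k, and the search visits at most M² pairs with k² candidates
each. Since Mk = k^(s+1) = n^e (`size_rpow`), the total is O(n^(2e)). The machine has no integer
division, so addresses, quotients and remainders are tabulated by additions. The program is verified
with proof rules that carry time bounds (`Does`, `Frame`). -/

namespace AlgRAM

/-- The integer registers, integer arrays, complex registers and complex arrays that a program
may write to. -/
def Prog.writes : Prog → List ℕ × List ℕ × List ℕ × List ℕ
  | .skip => ([], [], [], [])
  | .setI x _ => ([x], [], [], [])
  | .setC x _ => ([], [], [x], [])
  | .storeI a _ _ => ([], [a], [], [])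
  | .storeC a _ _ => ([], [], [], [a])
  | .seq p p' => (p.writes.1 ++ p'.writes.1, p.writes.2.1 ++ p'.writes.2.1,
      p.writes.2.2.1 ++ p'.writes.2.2.1, p.writes.2.2.2 ++ p'.writes.2.2.2)
  | .ite _ p p' => (p.writes.1 ++ p'.writes.1, p.writes.2.1 ++ p'.writes.2.1,
      p.writes.2.2.1 ++ p'.writes.2.2.1, p.writes.2.2.2 ++ p'.writes.2.2.2)
  | .while _ p => p.writes

/-- The states differ at most in the cells that the program may write to. -/
structure Frame (p : Prog) (σ σ' : State) : Prop where
  ireg : ∀ x, x ∉ p.writes.1 → σ'.ireg x = σ.ireg x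
  iarr : ∀ a, a ∉ p.writes.2.1 → σ'.iarr a = σ.iarr a
  creg : ∀ x, x ∉ p.writes.2.2.1 → σ'.creg x = σ.creg x
  carr : ∀ a, a ∉ p.writes.2.2.2 → σ'.carr a = σ.carr a

theorem Frame.refl (p : Prog) (σ : State) : Frame p σ σ :=
  ⟨fun _ _ => rfl, fun _ _ => rfl, fun _ _ => rfl, fun _ _ => rfl⟩

theorem Frame.trans {p : Prog} {σ₁ σ₂ σ₃ : State} (h : Frame p σ₁ σ₂) (h' : Frame p σ₂ σ₃) :
    Frame p σ₁ σ₃ :=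
  ⟨fun x hx => (h'.ireg x hx).trans (h.ireg x hx), fun x hx => (h'.iarr x hx).trans (h.iarr x hx),
   fun x hx => (h'.creg x hx).trans (h.creg x hx), fun x hx => (h'.carr x hx).trans (h.carr x hx)⟩

/-! ### The state after a write -/

section Simp

variable (σ : State) (x y : ℕ) (i v : ℤ) (c : ℂ)

@[simp] theorem State.setI_ireg : (σ.setI x v).ireg y = if y = x then v else σ.ireg y := by
  simp [State.setI, Function.update_apply]
@[simp] theorem State.setI_iarr : (σ.setI x v).iarr = σ.iarr := rfl
@[simp] theorem State.setI_creg : (σ.setI x v).creg = σ.creg := rfl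
@[simp] theorem State.setI_carr : (σ.setI x v).carr = σ.carr := rfl
@[simp] theorem State.setC_ireg : (σ.setC x c).ireg = σ.ireg := rfl
@[simp] theorem State.setC_iarr : (σ.setC x c).iarr = σ.iarr := rfl
@[simp] theorem State.setC_creg : (σ.setC x c).creg y = if y = x then c else σ.creg y := by
  simp [State.setC, Function.update_apply]
@[simp] theorem State.setC_carr : (σ.setC x c).carr = σ.carr := rfl
@[simp] theorem State.storeI_ireg : (σ.storeI x i v).ireg = σ.ireg := rfl
@[simp] theorem State.storeI_iarr :
    (σ.storeI x i v).iarr y = if y = x then Function.update (σ.iarr x) i v else σ.iarr y := by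
  simp [State.storeI, Function.update_apply]
@[simp] theorem State.storeI_creg : (σ.storeI x i v).creg = σ.creg := rfl
@[simp] theorem State.storeI_carr : (σ.storeI x i v).carr = σ.carr := rfl
@[simp] theorem State.storeC_ireg : (σ.storeC x i c).ireg = σ.ireg := rfl
@[simp] theorem State.storeC_iarr : (σ.storeC x i c).iarr = σ.iarr := rfl
@[simp] theorem State.storeC_creg : (σ.storeC x i c).creg = σ.creg := rfl
@[simp] theorem State.storeC_carr :
    (σ.storeC x i c).carr y = if y = x then Function.update (σ.carr x) i c else σ.carr y := by
  simp [State.storeC, Function.update_apply]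

end Simp

attribute [simp] IExpr.val CExpr.val IExpr.cost CExpr.cost

@[simp] theorem Cond.holds_ieq (σ : State) (e f : IExpr) :
    (Cond.ieq e f).Holds σ ↔ e.val σ = f.val σ := Iff.rfl
@[simp] theorem Cond.holds_ile (σ : State) (e f : IExpr) :
    (Cond.ile e f).Holds σ ↔ e.val σ ≤ f.val σ := Iff.rfl
@[simp] theorem Cond.holds_ceq (σ : State) (e f : CExpr) :
    (Cond.ceq e f).Holds σ ↔ e.val σ = f.val σ := Iff.rfl

/-- What survives a subprogram is hereby settled by `decide` on its lists of `writes`; all later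
proofs transport registers and arrays in this way. -/
theorem Runs.frame {p : Prog} {σ σ' : State} {t : ℕ} (h : Runs p σ t σ') : Frame p σ σ' := by
  induction h with
  | skip σ => exact .refl _ _
  | setI σ x e =>
    exact ⟨fun y hy => by simp_all [Prog.writes], fun _ _ => rfl, fun _ _ => rfl, fun _ _ => rfl⟩
  | setC σ x e =>
    exact ⟨fun _ _ => rfl, fun _ _ => rfl, fun y hy => by simp_all [Prog.writes], fun _ _ => rfl⟩
  | storeI σ a i e =>
    exact ⟨fun _ _ => rfl, fun y hy => by simp_all [Prog.writes], fun _ _ => rfl, fun _ _ => rfl⟩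
  | storeC σ a i e =>
    exact ⟨fun _ _ => rfl, fun _ _ => rfl, fun _ _ => rfl, fun y hy => by simp_all [Prog.writes]⟩
  | seq _ _ ih ih' =>
    constructor <;> intro x hx <;> simp only [Prog.writes, List.mem_append, not_or] at hx
    · exact (ih'.ireg x hx.2).trans (ih.ireg x hx.1)
    · exact (ih'.iarr x hx.2).trans (ih.iarr x hx.1)
    · exact (ih'.creg x hx.2).trans (ih.creg x hx.1)
    · exact (ih'.carr x hx.2).trans (ih.carr x hx.1)
  | ite_true _ _ ih =>
    constructor <;> intro x hx <;> simp only [Prog.writes, List.mem_append, not_or] at hx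
    exacts [ih.ireg x hx.1, ih.iarr x hx.1, ih.creg x hx.1, ih.carr x hx.1]
  | ite_false _ _ ih =>
    constructor <;> intro x hx <;> simp only [Prog.writes, List.mem_append, not_or] at hx
    exacts [ih.ireg x hx.2, ih.iarr x hx.2, ih.creg x hx.2, ih.carr x hx.2]
  | while_true _ _ _ ih ih' =>
    exact Frame.trans (p := .while _ _) ⟨ih.ireg, ih.iarr, ih.creg, ih.carr⟩ ih'
  | while_false _ => exact .refl _ _

/-- Started in `σ`, the program halts within time `T` in a state that satisfies `R`. -/
def Does (p : Prog) (σ : State) (T : ℕ) (R : State → Prop) : Prop :=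
  ∃ t σ', Runs p σ t σ' ∧ t ≤ T ∧ R σ'

/-! ### Rules for total correctness with time bounds -/

namespace Does

variable {p p' : Prog} {σ : State} {T T' : ℕ} {R R' : State → Prop} {b : Cond}

theorem frame (h : Does p σ T R) : Does p σ T fun σ' => Frame p σ σ' ∧ R σ' := by
  obtain ⟨t, σ', h, ht, hR⟩ := h
  exact ⟨t, σ', h, ht, h.frame, hR⟩

theorem mono (h : Does p σ T R) (hT : T ≤ T') (hR : ∀ σ', R σ' → R' σ') : Does p σ T' R' := by
  obtain ⟨t, σ', h, ht, hR'⟩ := h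
  exact ⟨t, σ', h, ht.trans hT, hR _ hR'⟩

theorem skip (h : R σ) : Does .skip σ 1 R := ⟨_, _, .skip σ, le_rfl, h⟩

theorem setI {x : ℕ} {e : IExpr} (h : R (σ.setI x (e.val σ))) :
    Does (.setI x e) σ (e.cost + 1) R := ⟨_, _, .setI σ x e, le_rfl, h⟩

theorem setC {x : ℕ} {e : CExpr} (h : R (σ.setC x (e.val σ))) :
    Does (.setC x e) σ (e.cost + 1) R := ⟨_, _, .setC σ x e, le_rfl, h⟩

theorem storeI {a : ℕ} {i e : IExpr} (h : R (σ.storeI a (i.val σ) (e.val σ))) :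
    Does (.storeI a i e) σ (i.cost + e.cost + 1) R := ⟨_, _, .storeI σ a i e, le_rfl, h⟩

theorem storeC {a : ℕ} {i : IExpr} {e : CExpr} (h : R (σ.storeC a (i.val σ) (e.val σ))) :
    Does (.storeC a i e) σ (i.cost + e.cost + 1) R := ⟨_, _, .storeC σ a i e, le_rfl, h⟩

theorem seq (h : Does p σ T fun σ' => Does p' σ' T' R) : Does (.seq p p') σ (T + T') R := by
  obtain ⟨t, σ', h, ht, t', σ'', h', ht', hR⟩ := h
  exact ⟨_, _, h.seq h', add_le_add ht ht', hR⟩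

theorem ite (h : b.Holds σ → Does p σ T R) (h' : ¬ b.Holds σ → Does p' σ T' R) :
    Does (.ite b p p') σ (b.cost + max T T') R := by
  by_cases hb : b.Holds σ
  · obtain ⟨t, σ', h, ht, hR⟩ := h hb
    exact ⟨_, _, .ite_true hb h, by gcongr; exact ht.trans (le_max_left ..), hR⟩
  · obtain ⟨t, σ', h, ht, hR⟩ := h' hb
    exact ⟨_, _, .ite_false hb h, by gcongr; exact ht.trans (le_max_right ..), hR⟩

/-- The rule for loops with at most `N` rounds. -/
theorem loop (N : ℕ) (Inv : ℕ → State → Prop) (h0 : Inv 0 σ)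
    (hstep : ∀ n σ', Frame (.while b p) σ σ' → Inv n σ' → b.Holds σ' →
      n < N ∧ Does p σ' T (Inv (n + 1))) :
    Does (.while b p) σ (N * (b.cost + T) + b.cost) fun σ' =>
      Frame (.while b p) σ σ' ∧ ¬ b.Holds σ' ∧ ∃ n ≤ N, Inv n σ' := by
  -- Induction on the number `m` of rounds still allowed. For `m = 0` another round is excluded by
  -- `n < N`.
  have key : ∀ m n σ', n + m = N → Frame (.while b p) σ σ' → Inv n σ' →
      Does (.while b p) σ' (m * (b.cost + T) + b.cost) fun σ' =>
        ¬ b.Holds σ' ∧ ∃ n ≤ N, Inv n σ' := by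
    intro m
    induction m with
    | zero =>
      intro n σ' hn hf hI
      have hb : ¬ b.Holds σ' := fun hb => by have := (hstep n σ' hf hI hb).1; omega
      exact ⟨_, _, .while_false hb, by simp, hb, n, by omega, hI⟩
    | succ m ih =>
      intro n σ' hn hf hI
      by_cases hb : b.Holds σ'
      · obtain ⟨-, t, σ₁, h₁, ht₁, hI₁⟩ := hstep n σ' hf hI hb
        obtain ⟨t₂, σ₂, h₂, ht₂, hR⟩ := ih (n + 1) σ₁ (by omega)
          (hf.trans ⟨h₁.frame.ireg, h₁.frame.iarr, h₁.frame.creg, h₁.frame.carr⟩) hI₁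
        exact ⟨_, _, .while_true hb h₁ h₂, by rw [add_mul]; omega, hR⟩
      · exact ⟨_, _, .while_false hb, by simp, hb, n, by omega, hI⟩
  exact (key N 0 σ (by omega) (.refl _ _) h0).frame

end Does

/-- Repeat `p` while the integer register `x` runs from `0` to the value of the integer register
`y`. -/
def Prog.count (x y : ℕ) (p : Prog) : Prog :=
  .seq (.setI x (.const 0)) (.while (.ile (.add (.reg x) (.const 1)) (.reg y))
    (.seq p (.setI x (.add (.reg x) (.const 1)))))

/-- The rule for counting loops. -/
theorem Does.count {p : Prog} {σ : State} {T x y : ℕ} (N : ℕ) (hN : σ.ireg y = N)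
    (hx : x ∉ p.writes.1) (hy : y ∉ p.writes.1) (hxy : y ≠ x) (Inv : ℕ → State → Prop)
    (h0 : Inv 0 (σ.setI x 0))
    (hstep : ∀ n σ', n < N → Frame (.count x y p) σ σ' → σ'.ireg x = n → Inv n σ' →
      Does p σ' T fun σ'' => Inv (n + 1) (σ''.setI x ((n : ℤ) + 1))) :
    Does (.count x y p) σ (N * (T + 9) + 7) fun σ' => Frame (.count x y p) σ σ' ∧ Inv N σ' := by
  have hw : Frame (.count x y p) σ (σ.setI x 0) :=
    ⟨fun z hz => by
      have : z ≠ x := by rintro rfl; simp [Prog.count, Prog.writes] at hz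
      simp [this], fun _ _ => rfl, fun _ _ => rfl, fun _ _ => rfl⟩
  refine Does.frame ?_
  -- Setting the counter takes time 2. A round pays 5 for the test, `T` for the body and 4 for the
  -- increment; the final failing test pays 5.
  refine (Does.seq (T := 2) (T' := N * (5 + (T + 4)) + 5) ?_).mono (by ring_nf; omega)
    (fun _ h => h)
  refine Does.setI ?_
  refine (Does.loop N (fun n σ' => σ'.ireg x = n ∧ Inv n σ') ?_ ?_).mono
    (T := N * (5 + (T + 4)) + 5) le_rfl ?_
  · simpa using h0
  · rintro n σ' hf ⟨hn, hI⟩ hb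
    have hf' : Frame (.count x y p) σ σ' := by
      refine hw.trans ⟨fun z hz => hf.ireg z ?_, fun z hz => hf.iarr z ?_,
        fun z hz => hf.creg z ?_, fun z hz => hf.carr z ?_⟩ <;>
      simp_all [Prog.count, Prog.writes]
    have hyN : σ'.ireg y = N := by
      rw [hf'.ireg y (by simp [Prog.count, Prog.writes, hy, hxy]), hN]
    simp only [Cond.Holds, IExpr.val, hn, hyN] at hb
    have hnN : n < N := by omega
    refine ⟨hnN, Does.seq (T' := 4) (((hstep n σ' hnN hf' hn hI).frame).mono le_rfl ?_)⟩
    rintro σ'' ⟨hf'', hI'⟩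
    have hn' : σ''.ireg x = n := by rw [hf''.ireg x hx, hn]
    refine Does.setI ?_
    simpa [hn'] using hI'
  · rintro σ' ⟨hf, hb, n, hn, hx, hI⟩
    have hyN : σ'.ireg y = N := by
      rw [hf.ireg y (by simp [Prog.writes, hy, hxy])]; simp [hxy, hN]
    simp only [Cond.Holds, IExpr.val, hx, hyN] at hb
    obtain rfl : n = N := by omega
    exact hI

/-- The program has no loops. -/
def Prog.straight : Prog → Bool
  | .seq p p' => p.straight && p'.straight
  | .ite _ p p' => p.straight && p'.straight
  | .while _ _ => false
  | _ => true

open Classical in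
/-- The effect of a program without loops. -/
noncomputable def Prog.exec : Prog → State → State
  | .skip, σ => σ
  | .setI x e, σ => σ.setI x (e.val σ)
  | .setC x e, σ => σ.setC x (e.val σ)
  | .storeI a i e, σ => σ.storeI a (i.val σ) (e.val σ)
  | .storeC a i e, σ => σ.storeC a (i.val σ) (e.val σ)
  | .seq p p', σ => p'.exec (p.exec σ)
  | .ite b p p', σ => if b.Holds σ then p.exec σ else p'.exec σ
  | .while _ _, σ => σ

/-- A bound for the time of a program without loops. -/
def Prog.cost : Prog → ℕ
  | .skip => 1
  | .setI _ e => e.cost + 1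
  | .setC _ e => e.cost + 1
  | .storeI _ i e => i.cost + e.cost + 1
  | .storeC _ i e => i.cost + e.cost + 1
  | .seq p p' => p.cost + p'.cost
  | .ite b p p' => b.cost + max p.cost p'.cost
  | .while _ _ => 0

theorem Does.exec {p : Prog} (hp : p.straight = true) (σ : State) :
    Does p σ p.cost fun σ' => σ' = p.exec σ := by
  induction p generalizing σ with
  | skip => exact .skip rfl
  | setI => exact .setI rfl
  | setC => exact .setC rfl
  | storeI => exact .storeI rfl
  | storeC => exact .storeC rfl
  | seq p p' ih ih' =>
    simp only [Prog.straight, Bool.and_eq_true] at hp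
    refine Does.seq ((ih hp.1 σ).mono le_rfl ?_)
    rintro _ rfl
    exact ih' hp.2 _
  | ite b p p' ih ih' =>
    simp only [Prog.straight, Bool.and_eq_true] at hp
    refine Does.ite (fun h => ?_) fun h => ?_
    · simpa [Prog.exec, h] using ih hp.1 σ
    · simpa [Prog.exec, h] using ih' hp.2 σ
  | _ => simp [Prog.straight] at hp

theorem Does.straight {p : Prog} {σ : State} {T : ℕ} {R : State → Prop} (hp : p.straight = true)
    (hT : p.cost ≤ T) (hR : R (p.exec σ)) : Does p σ T R :=
  (Does.exec hp σ).mono hT (by rintro _ rfl; exact hR)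

theorem Does.seq_straight {p p' : Prog} {σ : State} {T T' : ℕ} {R : State → Prop}
    (hp : p.straight = true) (hT : p.cost + T' ≤ T) (h : Does p' (p.exec σ) T' R) :
    Does (.seq p p') σ T R :=
  (Does.seq ((Does.exec hp σ).mono le_rfl (by rintro _ rfl; exact h))).mono hT fun _ h => h

theorem Does.seq_then {p p' : Prog} {σ : State} {T T₁ T₂ : ℕ} {R R' : State → Prop}
    (h : Does p σ T₁ R') (hT : T₁ + T₂ ≤ T) (h' : ∀ σ', R' σ' → Does p' σ' T₂ R) :
    Does (.seq p p') σ T R :=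
  (Does.seq (h.mono le_rfl h')).mono hT fun _ h => h

end AlgRAM

namespace AlgRAM

/-! ### The table of addresses -/

/-- The base-`k` digit of `x` at position `i`. -/
def digit (k i x : ℕ) : ℕ := x / k ^ i % k

/-- By the hypothesis no carry leaves position `n`, so only the digit there changes. -/
theorem digit_add_pow {k n y : ℕ} (hk : 0 < k) (hy : y + k ^ n < k ^ (n + 1)) (i : ℕ) :
    digit k i (y + k ^ n) = digit k i y + if i = n then 1 else 0 := by
  unfold digit
  rcases lt_trichotomy i n with h | rfl | h
  · obtain ⟨m, rfl⟩ := Nat.exists_eq_add_of_lt h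
    have : k ^ (i + m + 1) = k ^ i * (k * k ^ m) := by ring
    rw [this, Nat.add_mul_div_left _ _ (by positivity), Nat.add_mul_mod_self_left]
    simp [show i ≠ i + m + 1 by omega]
  · have h1 : (y + k ^ i) / k ^ i = y / k ^ i + 1 := Nat.add_div_right _ (by positivity)
    have h2 : (y + k ^ i) / k ^ i < k := Nat.div_lt_of_lt_mul (by rwa [pow_succ] at hy)
    rw [h1] at h2 ⊢
    rw [Nat.mod_eq_of_lt h2, Nat.mod_eq_of_lt (by omega)]
    simp
  · have : k ^ (n + 1) ≤ k ^ i := Nat.pow_le_pow_right hk h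
    rw [Nat.div_eq_of_lt (by omega), Nat.div_eq_of_lt (by omega)]
    simp [h.ne']

/-- The address in the table of a local transition function of the row of the word that is read
off from the digits of `x` at the positions `o 0, …, o (r - 1)`. -/
def rowAddress (k r : ℕ) (o : ℕ → ℕ) (x : ℕ) : ℕ :=
  ∑ j ∈ Finset.range r, digit k (o j) x * k ^ (j + 1)

/-- The recursion that fills the table with one addition per entry. If `o` is injective, at most one
summand is nonzero. -/
theorem rowAddress_add_pow {k n y : ℕ} (hk : 0 < k) (hy : y + k ^ n < k ^ (n + 1)) (r : ℕ)
    (o : ℕ → ℕ) : rowAddress k r o (y + k ^ n) =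
      rowAddress k r o y + ∑ j ∈ Finset.range r, if o j = n then k ^ (j + 1) else 0 := by
  simp only [rowAddress, digit_add_pow hk hy, add_mul, Finset.sum_add_distrib, ite_mul, one_mul,
    zero_mul]

/-- Computes the span (in register 4), the number of words whose length is the span (in register
6), the number of words that are shorter by one (in register 9), and the row addresses of all words
(in array 1). -/
def addressProg : Prog :=
  .seq (.seq (.setI 4 (.add (.sub (.load 0 (.sub (.reg 2) (.const 1))) (.load 0 (.const 0)))
      (.const 1)))
    (.seq (.setI 6 (.const 1)) (.seq (.setI 8 (.reg 1)) (.setI 7 (.const 0)))))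
  (.count 5 4 (.seq
    (.seq (.ite (.ieq (.sub (.load 0 (.reg 7)) (.load 0 (.const 0))) (.reg 5))
        (.seq (.setI 10 (.reg 8)) (.seq (.setI 8 (.mul (.reg 8) (.reg 1)))
          (.setI 7 (.add (.reg 7) (.const 1)))))
        (.setI 10 (.const 0)))
      (.seq (.setI 9 (.reg 6)) (.setI 11 (.sub (.mul (.reg 6) (.reg 1)) (.reg 6)))))
    (.seq (.count 12 11 (.storeI 1 (.add (.reg 12) (.reg 6)) (.add (.load 1 (.reg 12)) (.reg 10))))
      (.setI 6 (.mul (.reg 6) (.reg 1))))))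

theorem addressProg_inner {σ : State} {k n r : ℕ} {o : ℕ → ℕ} (hk : 0 < k)
    (h6 : σ.ireg 6 = (k : ℤ) ^ n) (h11 : σ.ireg 11 = (k : ℤ) ^ n * k - (k : ℤ) ^ n)
    (h10 : σ.ireg 10 = ∑ j ∈ Finset.range r, if o j = n then (k : ℤ) ^ (j + 1) else 0)
    (hT : ∀ x < k ^ n, σ.iarr 1 x = rowAddress k r o x) :
    Does (.count 12 11 (.storeI 1 (.add (.reg 12) (.reg 6)) (.add (.load 1 (.reg 12)) (.reg 10))))
      σ (k ^ (n + 1) * 17 + 7) fun σ' =>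
        ∀ x < k ^ (n + 1), σ'.iarr 1 x = rowAddress k r o x := by
  have hle : k ^ n ≤ k ^ (n + 1) := Nat.pow_le_pow_right hk (by omega)
  -- Round `m` derives the entry `k ^ n + m` from the entry `m`, which may itself have been filled
  -- by this loop; this is how leading digits above 1 arise.
  refine (Does.count (T := 8) (k ^ (n + 1) - k ^ n) ?_ (by decide) (by decide) (by decide)
    (fun m σ' => ∀ x < k ^ n + m, σ'.iarr 1 x = rowAddress k r o x) ?_ ?_).mono ?_ ?_
  · rw [h11, Nat.cast_sub hle]; push_cast; ring
  · simpa using hT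
  · intro m σ' hm hf h12 hI
    refine Does.straight rfl (by decide) ?_
    have h6' := (hf.ireg 6 (by decide)).trans h6
    have h10' := (hf.ireg 10 (by decide)).trans h10
    intro x hx
    simp only [Prog.exec, State.setI_iarr, State.storeI_iarr, if_true, IExpr.val, h12, h6', h10']
    rw [hI m (by have := Nat.pow_pos (n := n) hk; omega)]
    by_cases hxm : x = k ^ n + m
    · subst hxm
      rw [add_comm (k ^ n), rowAddress_add_pow hk (by omega)]
      simp
    · rw [Function.update_of_ne (by norm_cast; omega)]
      exact hI x (by omega)
  · gcongr; omega
  · rintro σ' ⟨-, h⟩ x hx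
    exact h x (by omega)

theorem addressProg_spec {σ : State} {k r : ℕ} {o : ℕ → ℕ} (hk : 0 < k) (hr : 1 ≤ r)
    (h1 : σ.ireg 1 = k) (h2 : σ.ireg 2 = r) (ho : ∀ i j, i < j → j < r → o i < o j)
    (h0 : ∀ j < r, σ.iarr 0 j - σ.iarr 0 0 = o j) (hT : σ.iarr 1 0 = 0) :
    Does addressProg σ ((o (r - 1) + 1) * (k ^ (o (r - 1) + 1) * 17 + 66) + 100) fun σ' =>
      σ'.ireg 6 = (k : ℤ) ^ (o (r - 1) + 1) ∧ σ'.ireg 9 = (k : ℤ) ^ o (r - 1) ∧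
      ∀ x < k ^ (o (r - 1) + 1), σ'.iarr 1 x = rowAddress k r o x := by
  have hlast : σ.iarr 0 ((r : ℤ) - 1) - σ.iarr 0 0 = o (r - 1) := by
    rw [← h0 (r - 1) (by omega)]; push_cast [hr]; rfl
  have ho' : ∀ j < r, o j ≤ o (r - 1) := fun j hj => by
    rcases Nat.lt_or_ge j (r - 1) with h | h
    · exact (ho j (r - 1) h (by omega)).le
    · rw [show j = r - 1 by omega]
  refine Does.seq_straight (T' := (o (r - 1) + 1) * (k ^ (o (r - 1) + 1) * 17 + 66) + 7) rfl
    (by simp [Prog.cost]; omega) ?_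
  -- Register 7 holds the number `j` of neighbors with offset below `n`, and register 8 the place
  -- value `k ^ (j + 1)` of the next one (the digit 0 of an address is the output state). Position
  -- `n` contributes that value if `o j = n` and nothing otherwise.
  refine (Does.count (T := k ^ (o (r - 1) + 1) * 17 + 57) (o (r - 1) + 1) ?_ (by decide)
    (by decide) (by decide)
    (fun n σ' => σ'.ireg 6 = (k : ℤ) ^ n ∧ (1 ≤ n → σ'.ireg 9 = (k : ℤ) ^ (n - 1)) ∧
      (∀ x < k ^ n, σ'.iarr 1 x = rowAddress k r o x) ∧
      ∃ j ≤ r, σ'.ireg 7 = j ∧ σ'.ireg 8 = (k : ℤ) ^ (j + 1) ∧ ∀ i < r, i < j ↔ o i < n)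
    ?_ ?_).mono ?_ ?_
  · simp [Prog.exec, h2, hlast]
  · refine ⟨by simp [Prog.exec], by simp, ?_, 0, by omega, by simp [Prog.exec],
      by simp [Prog.exec, h1], by simp⟩
    intro x hx
    obtain rfl : x = 0 := by simpa using hx
    simp [Prog.exec, hT, rowAddress, digit]
  · rintro n σ' hn hf h5 ⟨h6, h9, hI, j, hj, h7, h8, hij⟩
    have h1' : σ'.ireg 1 = k := by rw [hf.ireg 1 (by decide)]; simp [Prog.exec, h1]
    have h0' : σ'.iarr 0 = σ.iarr 0 := by rw [hf.iarr 0 (by decide)]; simp [Prog.exec]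
    have hmono : k ^ (n + 1) ≤ k ^ (o (r - 1) + 1) := Nat.pow_le_pow_right hk (by omega)
    refine Does.seq_straight (T' := k ^ (n + 1) * 17 + 7 + 4) rfl
      (by simp [Prog.cost, Cond.cost]; omega) ?_
    have hjr : j < r := by
      by_contra h
      obtain rfl : j = r := by omega
      have := (hij (j - 1) (by omega)).1 (by omega)
      omega
    have hoj : n ≤ o j := by
      have := (hij j hjr).not.1 (lt_irrefl _)
      omega
    by_cases hjn : o j = n
    · have hb : σ'.iarr 0 j - σ'.iarr 0 0 = n := by rw [h0', h0 j hjr, hjn]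
      refine Does.seq_then (T₂ := 4) (Does.frame (addressProg_inner (o := o) (r := r) hk (n := n)
        ?_ ?_ ?_ ?_)) (by omega) ?_
      · simp [Prog.exec, h7, hb, h5, h6]
      · simp [Prog.exec, h7, hb, h5, h6, h1']
      · rw [Finset.sum_eq_single j]
        · simp [Prog.exec, h7, hb, h5, h8, hjn]
        · intro i hi hij'
          rw [if_neg]
          rintro h
          rcases lt_or_gt_of_ne hij' with h' | h'
          · have := ho i j h' hjr; omega
          · have := ho j i h' (by simpa using hi); omega
        · simp [hjr]
      · simpa [Prog.exec, h7, hb, h5] using hI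
      · rintro σ'' ⟨hf', hI'⟩
        refine Does.straight rfl (by decide) ?_
        have e1 := hf'.ireg 1 (by decide)
        have e6 := hf'.ireg 6 (by decide)
        have e7 := hf'.ireg 7 (by decide)
        have e8 := hf'.ireg 8 (by decide)
        have e9 := hf'.ireg 9 (by decide)
        simp [Prog.exec, h7, hb, h5, h6, h1', h8] at e1 e6 e7 e8 e9
        refine ⟨by simp [Prog.exec, e1, e6, pow_succ], by simp [Prog.exec, e9],
          by simpa [Prog.exec] using hI', j + 1, by omega, by simp [Prog.exec, e7],
          by simp [Prog.exec, e8, pow_succ], fun i hi => ?_⟩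
        rcases lt_trichotomy i j with h | rfl | h
        · have := ho i j h hjr; omega
        · omega
        · have := ho j i h hi; omega
    · have hb : ¬ σ'.iarr 0 j - σ'.iarr 0 0 = n := by rw [h0', h0 j hjr]; exact_mod_cast hjn
      refine Does.seq_then (T₂ := 4) (Does.frame (addressProg_inner (o := o) (r := r) hk (n := n)
        ?_ ?_ ?_ ?_)) (by omega) ?_
      · simp [Prog.exec, h7, hb, h5, h6]
      · simp [Prog.exec, h7, hb, h5, h6, h1']
      · rw [Finset.sum_eq_zero]
        · simp [Prog.exec, h7, hb, h5]
        · intro i hi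
          rw [if_neg]
          rintro h
          rcases lt_or_ge i j with h' | h'
          · have := (hij i (by simpa using hi)).1 h'; omega
          · rcases h'.eq_or_lt with h' | h'
            · subst h'; exact hjn h
            · have := ho j i h' (by simpa using hi); omega
      · simpa [Prog.exec, h7, hb, h5] using hI
      · rintro σ'' ⟨hf', hI'⟩
        refine Does.straight rfl (by decide) ?_
        have e1 := hf'.ireg 1 (by decide)
        have e6 := hf'.ireg 6 (by decide)
        have e7 := hf'.ireg 7 (by decide)
        have e8 := hf'.ireg 8 (by decide)
        have e9 := hf'.ireg 9 (by decide)
        simp [Prog.exec, h7, hb, h5, h6, h1', h8] at e1 e6 e7 e8 e9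
        refine ⟨by simp [Prog.exec, e1, e6, pow_succ], by simp [Prog.exec, e9],
          by simpa [Prog.exec] using hI', j, by omega, by simp [Prog.exec, e7],
          by simp [Prog.exec, e8], fun i hi => ?_⟩
        rcases lt_trichotomy i j with h | rfl | h
        · have := (hij i hi).1 h; omega
        · omega
        · have := ho j i h hi; omega
  · gcongr
  · rintro σ' ⟨-, h6, h9, hI, -⟩
    exact ⟨h6, by simpa using h9 (by omega), hI⟩

/-! ### Quotients and remainders -/

/-- Computes `x / k` (in array 2) and `x % K` (in array 3) for all `x` below the number in register
6, where `k` and `K` are the numbers in the registers 1 and 9. -/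
def divModProg : Prog :=
  .count 13 6 (.seq
    (.ite (.ile (.reg 1) (.reg 13))
      (.storeI 2 (.reg 13) (.add (.load 2 (.sub (.reg 13) (.reg 1))) (.const 1)))
      (.storeI 2 (.reg 13) (.const 0)))
    (.ite (.ile (.reg 9) (.reg 13))
      (.storeI 3 (.reg 13) (.load 3 (.sub (.reg 13) (.reg 9))))
      (.storeI 3 (.reg 13) (.reg 13))))

/-- Both tables rest on earlier entries: `x / k = (x - k) / k + 1` and `x % K = (x - K) % K`. -/
theorem divModProg_spec {σ : State} {k K M : ℕ} (hk : 0 < k) (hK : 0 < K)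
    (h1 : σ.ireg 1 = k) (h9 : σ.ireg 9 = K) (h6 : σ.ireg 6 = M) :
    Does divModProg σ (M * 50 + 7) fun σ' =>
      ∀ x < M, σ'.iarr 2 x = (x / k : ℕ) ∧ σ'.iarr 3 x = (x % K : ℕ) := by
  refine (Does.count (T := 41) M h6 (by decide) (by decide) (by decide)
    (fun n σ' => ∀ x < n, σ'.iarr 2 x = (x / k : ℕ) ∧ σ'.iarr 3 x = (x % K : ℕ)) ?_ ?_).mono
    (by omega) (fun _ h => h.2)
  · simp
  · intro n σ' hn hf h13 hI
    refine Does.straight rfl (by decide) ?_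
    have h1' := (hf.ireg 1 (by decide)).trans h1
    have h9' := (hf.ireg 9 (by decide)).trans h9
    intro x hx
    have hdiv : k ≤ n → σ'.iarr 2 ((n : ℤ) - k) + 1 = (n / k : ℕ) := fun h => by
      have := (hI (n - k) (by omega)).1
      rw [Nat.div_eq_sub_div hk h]
      push_cast [h] at this ⊢
      rw [this]
    have hmod : K ≤ n → σ'.iarr 3 ((n : ℤ) - K) = (n % K : ℕ) := fun h => by
      have := (hI (n - K) (by omega)).2
      rw [Nat.mod_eq_sub_mod h]
      push_cast [h] at this ⊢
      rw [this]
    have hdiv' : ¬ k ≤ n → (n / k : ℕ) = 0 := fun h => Nat.div_eq_of_lt (by omega)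
    have hmod' : ¬ K ≤ n → (n % K : ℕ) = n := fun h => Nat.mod_eq_of_lt (by omega)
    rcases Nat.lt_succ_iff_lt_or_eq.1 hx with hx | rfl
    · have hne : (x : ℤ) ≠ n := by exact_mod_cast hx.ne
      by_cases hkn : k ≤ n <;> by_cases hKn : K ≤ n <;>
        simp [Prog.exec, h13, h1', h9', hkn, hKn, Function.update_of_ne hne, hI x hx]
    · by_cases hkn : k ≤ x <;> by_cases hKn : K ≤ x <;>
        simp [Prog.exec, h13, h1', h9', hkn, hKn, hdiv, hmod, hdiv', hmod']

end AlgRAM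

namespace AlgRAM

/-! ### The Gram matrix -/

/-- Stores the entries for one pair of words. -/
def gramStoreProg : Prog :=
  .seq (.setI 16 (.add (.mul (.reg 14) (.reg 6)) (.reg 15)))
    (.seq (.storeC 1 (.reg 16) (.reg 0))
    (.seq (.storeI 4 (.reg 16) (.mul (.add (.mul (.load 3 (.reg 14)) (.reg 6))
      (.load 3 (.reg 15))) (.reg 1)))
    (.seq (.ite (.ieq (.reg 14) (.reg 15)) (.storeI 5 (.reg 16) (.const 1))
      (.storeI 5 (.reg 16) (.const 0)))
    (.ite (.ceq (.reg 0) (.const 0)) (.storeI 6 (.reg 16) (.const 1))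
      (.storeI 6 (.reg 16) (.const 0))))))

/-- Computes the Gram matrix of the rows of the table (in array 1), the graph of pairs of words and
the set of its diagonal vertices (in the integer arrays 4 and 5), and marks (in the integer array 6)
the pairs of orthogonal rows. -/
def gramProg : Prog :=
  .count 14 6 (.count 15 6 (.seq (.setC 0 (.const 0)) (.seq
    (.count 17 1 (.setC 0 (.add (.reg 0)
      (.mul (.conj (.load 0 (.add (.load 1 (.reg 14)) (.reg 17))))
        (.load 0 (.add (.load 1 (.reg 15)) (.reg 17)))))))
    gramStoreProg)))

open Classical in
/-- The entries that `gramProg` computes for the pair of the words `i / M` and `i % M`. -/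
structure GramEntry (k K M : ℕ) (g : ℕ → ℕ → ℂ) (σ : State) (i : ℕ) : Prop where
  gram : σ.carr 1 i = g (i / M) (i % M)
  base : σ.iarr 4 i = ((i / M % K * M + i % M % K) * k : ℕ)
  diag : σ.iarr 5 i = if i / M = i % M then 1 else 0
  dead : σ.iarr 6 i = if g (i / M) (i % M) = 0 then 1 else 0

theorem gramStoreProg_exec {σ : State} {k K M x y : ℕ} {g : ℕ → ℕ → ℂ}
    (h1 : σ.ireg 1 = k) (h6 : σ.ireg 6 = M) (h14 : σ.ireg 14 = x) (h15 : σ.ireg 15 = y)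
    (hx : σ.iarr 3 x = (x % K : ℕ)) (hy : σ.iarr 3 y = (y % K : ℕ)) (hyM : y < M)
    (hg : σ.creg 0 = g x y) (hI : ∀ i < x * M + y, GramEntry k K M g σ i) :
    ∀ i < x * M + y + 1, GramEntry k K M g (gramStoreProg.exec σ) i := by
  intro i hi
  rcases (show i < x * M + y ∨ i = x * M + y by omega) with hi | rfl
  · have hne : (i : ℤ) ≠ x * M + y := by exact_mod_cast hi.ne
    obtain ⟨c1, c2, c3, c4⟩ := hI i hi
    constructor
    · rw [← c1]
      rcases Classical.propComplete (x = y) with hxy | hxy <;> by_cases hg0 : g x y = 0 <;>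
        simp [gramStoreProg, Prog.exec, h6, h14, h15, hg, hg0, hxy, hne]
    · rw [← c2]
      rcases Classical.propComplete (x = y) with hxy | hxy <;> by_cases hg0 : g x y = 0 <;>
        simp [gramStoreProg, Prog.exec, h6, h14, h15, hg, hg0, hxy, hne]
    · rw [← c3]
      rcases Classical.propComplete (x = y) with hxy | hxy <;> by_cases hg0 : g x y = 0 <;>
        simp [gramStoreProg, Prog.exec, h6, h14, h15, hg, hg0, hxy, hne]
    · rw [← c4]
      rcases Classical.propComplete (x = y) with hxy | hxy <;> by_cases hg0 : g x y = 0 <;>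
        simp [gramStoreProg, Prog.exec, h6, h14, h15, hg, hg0, hxy, hne]
  · have hdiv : (x * M + y) / M = x := by
      rw [mul_comm, Nat.mul_add_div (by omega), Nat.div_eq_of_lt hyM, add_zero]
    have hmod : (x * M + y) % M = y := by
      rw [mul_comm, Nat.mul_add_mod, Nat.mod_eq_of_lt hyM]
    constructor <;> rw [hdiv, hmod] <;> rcases Classical.propComplete (x = y) with hxy | hxy <;>
      by_cases hg0 : g x y = 0 <;>
      simp [gramStoreProg, Prog.exec, h1, h6, h14, h15, hg, hg0, hxy, hx, hy]

/-- The marks in array 6 later serve the search as marks of visited vertices, so that pairs with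
vanishing Gram entry are never entered. -/
theorem gramProg_spec {σ : State} {k K M : ℕ} {T : ℕ → ℕ} {g : ℕ → ℕ → ℂ}
    (h1 : σ.ireg 1 = k) (h6 : σ.ireg 6 = M) (hT : ∀ x < M, σ.iarr 1 x = T x)
    (hlo : ∀ x < M, σ.iarr 3 x = (x % K : ℕ))
    (hg : ∀ x < M, ∀ y < M, g x y = ∑ z ∈ Finset.range k,
      star (σ.carr 0 (T x + z : ℕ)) * σ.carr 0 (T y + z : ℕ)) :
    Does gramProg σ (M * (M * (k * 24 + 100) + 16) + 7) fun σ' =>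
      ∀ i < M * M, GramEntry k K M g σ' i := by
  refine (Does.count (T := M * (k * 24 + 100) + 7) M h6 (by decide) (by decide) (by decide)
    (fun x σ' => ∀ i < x * M, GramEntry k K M g σ' i) (by simp) ?_).mono (by ring_nf; rfl)
    (fun _ h => h.2)
  intro x σ₁ hx hf₁ h14 hI
  have h6₁ := (hf₁.ireg 6 (by decide)).trans h6
  refine (Does.count (T := k * 24 + 91) M h6₁ (by decide) (by decide) (by decide)
    (fun y σ' => ∀ i < x * M + y, GramEntry k K M g σ' i)
    (fun i hi => ⟨(hI i hi).gram, (hI i hi).base, (hI i hi).diag, (hI i hi).dead⟩) ?_).mono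
    (by ring_nf; rfl) ?_
  · intro y σ₂ hy hf₂ h15 hI
    have e0 := (hf₂.carr 0 (by decide)).trans (hf₁.carr 0 (by decide))
    have e1 := (hf₂.iarr 1 (by decide)).trans (hf₁.iarr 1 (by decide))
    have e3 := (hf₂.iarr 3 (by decide)).trans (hf₁.iarr 3 (by decide))
    have h1₂ := ((hf₂.ireg 1 (by decide)).trans (hf₁.ireg 1 (by decide))).trans h1
    have h6₂ := (hf₂.ireg 6 (by decide)).trans h6₁
    have h14₂ := (hf₂.ireg 14 (by decide)).trans h14
    refine Does.seq_straight (T' := k * 24 + 89) rfl (by simp [Prog.cost]; omega) ?_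
    refine Does.seq_then (T₁ := k * (15 + 9) + 7) (T₂ := 82) (Does.count (T := 15) k
      (by simpa [Prog.exec] using h1₂) (by decide) (by decide) (by decide)
      (fun n σ' => σ'.creg 0 = ∑ z ∈ Finset.range n,
        star (σ.carr 0 (T x + z : ℕ)) * σ.carr 0 (T y + z : ℕ)) (by simp [Prog.exec]) ?_)
      (by omega) ?_
    · intro z σ₃ hz hf₃ h17 hI₃
      have d0 : σ₃.carr 0 = σ.carr 0 := (hf₃.carr 0 (by decide)).trans e0
      have d1 : σ₃.iarr 1 = σ.iarr 1 := (hf₃.iarr 1 (by decide)).trans e1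
      have h14₃ : σ₃.ireg 14 = x := (hf₃.ireg 14 (by decide)).trans h14₂
      have h15₃ : σ₃.ireg 15 = y := (hf₃.ireg 15 (by decide)).trans h15
      refine Does.straight rfl (by decide) ?_
      simp [Prog.exec, Finset.sum_range_succ, hI₃, h14₃, h15₃, h17, d0, d1, hT x hx, hT y hy]
    · rintro σ₃ ⟨hf₃, hI₃⟩
      have d3 : σ₃.iarr 3 = σ.iarr 3 := (hf₃.iarr 3 (by decide)).trans e3
      have hlx : σ₃.iarr 3 x = (x % K : ℕ) := by rw [d3, hlo x hx]
      have hly : σ₃.iarr 3 y = (y % K : ℕ) := by rw [d3, hlo y hy]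
      have hg₃ : σ₃.creg 0 = g x y := by rw [hI₃, hg x hx y hy]
      refine Does.straight rfl (by decide) fun i hi => ?_
      obtain ⟨c1, c2, c3, c4⟩ := gramStoreProg_exec ((hf₃.ireg 1 (by decide)).trans h1₂)
        ((hf₃.ireg 6 (by decide)).trans h6₂) ((hf₃.ireg 14 (by decide)).trans h14₂)
        ((hf₃.ireg 15 (by decide)).trans h15) hlx hly hy hg₃ (fun i hi => by
          obtain ⟨c1, c2, c3, c4⟩ := hI i hi
          exact ⟨(congrFun (hf₃.carr 1 (by decide)) _).trans c1,
            (congrFun (hf₃.iarr 4 (by decide)) _).trans c2,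
            (congrFun (hf₃.iarr 5 (by decide)) _).trans c3,
            (congrFun (hf₃.iarr 6 (by decide)) _).trans c4⟩) i hi
      exact ⟨c1, c2, c3, c4⟩
  · rintro σ₂ ⟨-, h⟩ i hi
    obtain ⟨c1, c2, c3, c4⟩ := h i (by rwa [add_mul, one_mul] at hi)
    exact ⟨c1, c2, c3, c4⟩

/-! ### The potential -/

/-- The integer register `0` holds the truth value of a proposition. -/
def Flag (σ : State) (p : Prop) : Prop := (p → σ.ireg 0 = 1) ∧ (¬ p → σ.ireg 0 = 0)

theorem Flag.congr {σ σ' : State} {p q : Prop} (h : Flag σ p) (h0 : σ'.ireg 0 = σ.ireg 0)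
    (hpq : p ↔ q) : Flag σ' q := by
  rw [Flag, h0, ← hpq]; exact h

theorem Flag.of_false {σ : State} {p : Prop} (h0 : σ.ireg 0 = 0) (hp : ¬ p) : Flag σ p :=
  ⟨fun h => absurd h hp, fun _ => h0⟩

/-- The product of the weights of `x, x / k, x / k ^ 2, …` down to the leading digit. -/
noncomputable def potential (k : ℕ) (w : ℕ → ℂ) (x : ℕ) : ℂ :=
  if x / k < x then potential k w (x / k) * w x else 1
termination_by x

/-- The edges of the de Bruijn graph have the weights that the potential prescribes. -/
def IsPotential (k K M : ℕ) (w : ℕ → ℂ) : Prop :=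
  ∀ x < M, potential k w (x % K) = potential k w (x / k) * w x

/-- Computes the potential of the diagonal of the Gram matrix (in array 2) and compares it with the
diagonal. -/
def potentialProg : Prog :=
  .seq (.storeC 2 (.const 0) (.const 1)) (.count 18 6 (.seq
    (.ite (.ile (.const 1) (.reg 18)) (.ite (.ile (.add (.reg 18) (.const 1)) (.reg 9))
      (.storeC 2 (.reg 18) (.mul (.load 2 (.load 2 (.reg 18)))
        (.load 1 (.mul (.reg 18) (.add (.reg 6) (.const 1)))))) .skip) .skip)
    (.ite (.ceq (.load 2 (.load 3 (.reg 18))) (.mul (.load 2 (.load 2 (.reg 18)))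
        (.load 1 (.mul (.reg 18) (.add (.reg 6) (.const 1)))))) .skip (.setI 0 (.const 0)))))

/-- The numbers `x / k` and `x % K` are below `K` and at most `x`, so their potentials are known
when `x` is tested. For `0 < x < K` the value at `x % K = x` is stored just before, and the test
holds by construction. -/
theorem potentialProg_spec {σ : State} {k K M : ℕ} {w : ℕ → ℂ} (hk : 2 ≤ k) (hK : 0 < K)
    (hM : M = K * k) (h0 : σ.ireg 0 = 1) (h9 : σ.ireg 9 = K) (h6 : σ.ireg 6 = M)
    (hhi : ∀ x < M, σ.iarr 2 x = (x / k : ℕ)) (hlo : ∀ x < M, σ.iarr 3 x = (x % K : ℕ))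
    (hw : ∀ x < M, σ.carr 1 (x * (M + 1) : ℕ) = w x) :
    Does potentialProg σ (M * 100 + 16) fun σ' => Flag σ' (IsPotential k K M w) := by
  have hpot0 : potential k w 0 = 1 := by rw [potential]; simp
  refine Does.seq_straight (T' := M * 100 + 7) rfl (by simp [Prog.cost]; omega) ?_
  refine (Does.count (T := 91) M (by simpa [Prog.exec] using h6) (by decide) (by decide)
    (by decide) (fun n σ' => σ'.carr 2 0 = 1 ∧ (∀ x < n, x < K → σ'.carr 2 x = potential k w x) ∧
      Flag σ' (∀ x < n, potential k w (x % K) = potential k w (x / k) * w x)) ?_ ?_).mono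
    (by omega) (fun _ h => h.2.2.2)
  · simp [Prog.exec, Flag, h0]
  · rintro n σ₁ hn hf h18 ⟨hI0, hI, hF⟩
    have h9₁ : σ₁.ireg 9 = K := (hf.ireg 9 (by decide)).trans h9
    have h6₁ : σ₁.ireg 6 = M := (hf.ireg 6 (by decide)).trans h6
    have e2 : σ₁.iarr 2 n = (n / k : ℕ) := by
      rw [← hhi n hn]; exact congrFun (hf.iarr 2 (by decide)) _
    have e3 : σ₁.iarr 3 n = (n % K : ℕ) := by
      rw [← hlo n hn]; exact congrFun (hf.iarr 3 (by decide)) _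
    have e1 : σ₁.carr 1 (n * (M + 1)) = w n := by
      rw [← hw n hn, hf.carr 1 (by decide)]; simp [Prog.exec]
    have hdivK : n / k < K := Nat.div_lt_of_lt_mul (by rwa [mul_comm, ← hM])
    have hnext : Flag σ₁ (∀ x < n, potential k w (x % K) = potential k w (x / k) * w x) →
        (potential k w (n % K) = potential k w (n / k) * w n) →
        Flag σ₁ (∀ x < n + 1, potential k w (x % K) = potential k w (x / k) * w x) :=
      fun h h' => h.congr rfl ⟨fun h x hx => (Nat.lt_succ_iff_lt_or_eq.1 hx).elim (h x)
        (by rintro rfl; exact h'), fun h x hx => h x (by omega)⟩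
    -- At 0 nothing is stored, and the test asks whether the loop at the vertex 0 has weight 1.
    rcases Nat.eq_zero_or_pos n with rfl | hn0
    · refine Does.straight rfl (by decide) ?_
      simp only [Nat.cast_zero, zero_mul, Nat.zero_div, Nat.zero_mod] at *
      by_cases hw0 : w 0 = 1
      · refine ⟨?_, ?_, ?_⟩
        · simp [Prog.exec, h18, e3, e2, e1, hI0, hw0]
        · intro x hx _
          obtain rfl : x = 0 := by omega
          simp [Prog.exec, h18, e3, e2, e1, hI0, hw0, hpot0]
        · exact (hnext hF (by simp [hpot0, hw0])).congr
            (by simp [Prog.exec, h18, e3, e2, e1, hI0, hw0]) Iff.rfl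
      · refine ⟨?_, ?_, ?_⟩
        · simp [Prog.exec, h18, e3, e2, e1, hI0, Ne.symm hw0]
        · intro x hx _
          obtain rfl : x = 0 := by omega
          simp [Prog.exec, h18, e3, e2, e1, hI0, Ne.symm hw0, hpot0]
        · refine Flag.of_false (by simp [Prog.exec, h18, e3, e2, e1, hI0, Ne.symm hw0]) ?_
          intro h
          have := h 0 (by omega)
          simp [hpot0, Ne.symm hw0] at this
    · have hnk : n / k < n := Nat.div_lt_self hn0 hk
      have hdiv := hI (n / k) hnk hdivK
      have hn1 : (1 : ℤ) ≤ n := by exact_mod_cast hn0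
      have hnz : (0 : ℤ) ≠ n := by exact_mod_cast hn0.ne
      by_cases hnK : n < K
      · have hnK' : (n : ℤ) + 1 ≤ K := by exact_mod_cast hnK
        have hmod : n % K = n := Nat.mod_eq_of_lt hnK
        have hne : ((n / k : ℕ) : ℤ) ≠ n := by exact_mod_cast hnk.ne
        have hpn : potential k w n = potential k w (n / k) * w n := by
          rw [potential, if_pos hnk]
        rw [hmod] at e3
        refine Does.straight rfl (by decide) ?_
        push_cast at hne hdiv e2
        refine ⟨?_, ?_, ?_⟩
        · simp [Prog.exec, h18, h9₁, h6₁, hn1, hnK', e1, e2, e3, hdiv, hne, hI0, hnz]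
        · intro x hx hxK
          rcases Nat.lt_succ_iff_lt_or_eq.1 hx with hx | rfl
          · have hxn : (x : ℤ) ≠ n := by exact_mod_cast hx.ne
            simp [Prog.exec, h18, h9₁, h6₁, hn1, hnK', e1, e2, e3, hdiv, hne, hx.ne, hI x hx hxK]
          · simp [Prog.exec, h18, h9₁, h6₁, hn1, hnK', e1, e2, e3, hdiv, hne, hpn]
        · refine (hnext hF (by rw [hmod, hpn])).congr ?_ Iff.rfl
          simp [Prog.exec, h18, h9₁, h6₁, hn1, hnK', e1, e2, e3, hdiv, hne]
      · have hnK' : ¬ (n : ℤ) + 1 ≤ K := by exact_mod_cast hnK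
        have hmod := hI (n % K) (lt_of_lt_of_le (Nat.mod_lt _ hK) (by omega)) (Nat.mod_lt _ hK)
        refine Does.straight rfl (by decide) ?_
        push_cast at hmod hdiv e2 e3
        by_cases hc : potential k w (n % K) = potential k w (n / k) * w n
        · refine ⟨?_, ?_, ?_⟩
          · simp [Prog.exec, h18, h9₁, h6₁, hn1, hnK', e1, e2, e3, hdiv, hmod, hc, hI0]
          · intro x hx hxK
            simp [Prog.exec, h18, h9₁, h6₁, hn1, hnK', e1, e2, e3, hdiv, hmod, hc,
              hI x (by omega) hxK]
          · refine (hnext hF hc).congr ?_ Iff.rfl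
            simp [Prog.exec, h18, h9₁, h6₁, hn1, hnK', e1, e2, e3, hdiv, hmod, hc]
        · refine ⟨?_, ?_, ?_⟩
          · simp [Prog.exec, h18, h9₁, h6₁, hn1, hnK', e1, e2, e3, hdiv, hmod, hc, hI0]
          · intro x hx hxK
            simp [Prog.exec, h18, h9₁, h6₁, hn1, hnK', e1, e2, e3, hdiv, hmod, hc,
              hI x (by omega) hxK]
          · exact Flag.of_false
              (by simp [Prog.exec, h18, h9₁, h6₁, hn1, hnK', e1, e2, e3, hdiv, hmod, hc])
              fun h => hc (h n (by omega))

end AlgRAM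

namespace AlgRAM

/-! ### Graph search -/

/-- A finite directed graph with a set of diagonal vertices. The out-neighbors of `i` are the live
vertices among `base i + (b * M + c)` with `b, c < k`. -/
structure SearchGraph where
  k : ℕ
  M : ℕ
  N : ℕ
  base : ℕ → ℕ
  diag : ℕ → Prop
  live : ℕ → Prop

namespace SearchGraph

variable (G : SearchGraph)

/-- The candidates for out-neighbors. -/
def succ (i b c : ℕ) : ℕ := G.base i + (b * G.M + c)

/-- The vertices that can be reached from `0`. -/
def Reach : ℕ → Prop :=
  Relation.ReflTransGen (fun i j => ∃ b < G.k, ∃ c < G.k, j = G.succ i b c ∧ G.live j) 0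

/-- No off-diagonal vertex that can be reached from `0` has a diagonal candidate for an
out-neighbor. -/
def NoReturn : Prop :=
  ∀ i, G.Reach i → ∀ b < G.k, ∀ c < G.k, G.diag i ∨ ¬ G.diag (G.succ i b c)

open Classical in
/-- The graph is in memory. -/
structure InMemory (σ : State) : Prop where
  k : σ.ireg 1 = G.k
  M : σ.ireg 6 = G.M
  base : ∀ i < G.N, σ.iarr 4 i = G.base i
  diag : ∀ i < G.N, σ.iarr 5 i = if G.diag i then 1 else 0

open Classical in
/-- The invariant of the search: the queue is `l`, and the edges in `E` have been explored. -/
structure SearchInv (ok : Prop) (E : ℕ → ℕ → ℕ → Prop) (l : List ℕ) (σ : State) : Prop where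
  nodup : l.Nodup
  zero : 0 ∈ l
  sound : ∀ i ∈ l, i < G.N ∧ G.Reach i
  len : σ.ireg 20 = l.length
  queue : ∀ n (hn : n < l.length), σ.iarr 7 n = l[n]
  vis : ∀ i < G.N, σ.iarr 6 i = if G.live i ∧ i ∉ l then 0 else 1
  closed : ∀ i b c, E i b c → G.live (G.succ i b c) → G.succ i b c ∈ l
  flag : Flag σ (ok ∧ ∀ i b c, E i b c → G.diag i ∨ ¬ G.diag (G.succ i b c))

variable {G} {ok : Prop} {E E' : ℕ → ℕ → ℕ → Prop} {l : List ℕ} {σ σ' : State}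

theorem InMemory.congr (h : G.InMemory σ) (h1 : σ'.ireg 1 = σ.ireg 1) (h6 : σ'.ireg 6 = σ.ireg 6)
    (h4 : σ'.iarr 4 = σ.iarr 4) (h5 : σ'.iarr 5 = σ.iarr 5) : G.InMemory σ' :=
  ⟨h1.trans h.k, h6.trans h.M, h4 ▸ h.base, h5 ▸ h.diag⟩

theorem SearchInv.congr (h : G.SearchInv ok E l σ) (hE : ∀ i b c, E i b c ↔ E' i b c)
    (h0 : σ'.ireg 0 = σ.ireg 0) (h20 : σ'.ireg 20 = σ.ireg 20) (h6 : σ'.iarr 6 = σ.iarr 6)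
    (h7 : σ'.iarr 7 = σ.iarr 7) : G.SearchInv ok E' l σ' := by
  obtain rfl : E = E' := by ext; apply hE
  exact ⟨h.nodup, h.zero, h.sound, h20.trans h.len, h7 ▸ h.queue, h6 ▸ h.vis, h.closed,
    h.flag.congr h0 Iff.rfl⟩

/-- Bounds the number of rounds of the search. -/
theorem SearchInv.length_le (h : G.SearchInv ok E l σ) : l.length ≤ G.N := by
  have : l.toFinset ⊆ Finset.range G.N := fun i hi => by
    simpa using (h.sound i (by simpa using hi)).1
  simpa [List.toFinset_card_of_nodup h.nodup] using Finset.card_le_card this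

/-- Computes a candidate for an out-neighbor and clears the flag if it is diagonal whereas the
vertex is not. -/
def checkProg : Prog :=
  .seq (.setI 24 (.add (.load 4 (.reg 21)) (.add (.mul (.reg 22) (.reg 6)) (.reg 23))))
    (.ite (.ieq (.load 5 (.reg 21)) (.const 0))
      (.ite (.ieq (.load 5 (.reg 24)) (.const 1)) (.setI 0 (.const 0)) .skip) .skip)

/-- Appends the candidate to the queue if it is live and has not been visited. -/
def pushProg : Prog :=
  .ite (.ieq (.load 6 (.reg 24)) (.const 0))
    (.seq (.storeI 6 (.reg 24) (.const 1)) (.seq (.storeI 7 (.reg 20) (.reg 24))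
      (.setI 20 (.add (.reg 20) (.const 1))))) .skip

/-- Breadth-first search from the vertex `0`. -/
def searchProg : Prog :=
  .seq (.seq (.seq (.storeI 7 (.const 0) (.const 0)) (.storeI 6 (.const 0) (.const 1)))
    (.seq (.setI 19 (.const 0)) (.setI 20 (.const 1))))
  (.while (.ile (.add (.reg 19) (.const 1)) (.reg 20))
    (.seq (.seq (.setI 21 (.load 7 (.reg 19))) (.setI 19 (.add (.reg 19) (.const 1))))
      (.count 22 1 (.count 23 1 (.seq checkProg pushProg)))))

theorem checkProg_exec (hG : G.InMemory σ) {i b c : ℕ} (hi : i < G.N) (hj : G.succ i b c < G.N)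
    (h21 : σ.ireg 21 = i) (h22 : σ.ireg 22 = b) (h23 : σ.ireg 23 = c) {p : Prop} (hp : Flag σ p) :
    (checkProg.exec σ).ireg 24 = G.succ i b c ∧
      Flag (checkProg.exec σ) (p ∧ (G.diag i ∨ ¬ G.diag (G.succ i b c))) := by
  have e1 : (G.base i : ℤ) + (b * G.M + c) = (G.succ i b c : ℕ) := by simp [succ]
  by_cases hdi : G.diag i
  · have hi' : σ.iarr 5 i = 1 := by rw [hG.diag i hi, if_pos hdi]
    have : checkProg.exec σ = σ.setI 24 (G.succ i b c) := by
      simp [checkProg, Prog.exec, h21, h22, h23, hG.base i hi, hG.M, e1, hi']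
    rw [this]
    exact ⟨by simp, hp.congr (by simp) (by simp [hdi])⟩
  · have hi' : σ.iarr 5 i = 0 := by rw [hG.diag i hi, if_neg hdi]
    by_cases hdj : G.diag (G.succ i b c)
    · have hj' : σ.iarr 5 (G.succ i b c) = 1 := by rw [hG.diag _ hj, if_pos hdj]
      have : checkProg.exec σ = (σ.setI 24 (G.succ i b c)).setI 0 0 := by
        simp [checkProg, Prog.exec, h21, h22, h23, hG.base i hi, hG.M, e1, hi', hj']
      rw [this]
      exact ⟨by simp, .of_false (by simp) (by simp [hdi, hdj])⟩
    · have hj' : σ.iarr 5 (G.succ i b c) = 0 := by rw [hG.diag _ hj, if_neg hdj]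
      have : checkProg.exec σ = σ.setI 24 (G.succ i b c) := by
        simp [checkProg, Prog.exec, h21, h22, h23, hG.base i hi, hG.M, e1, hi', hj']
      rw [this]
      exact ⟨by simp, hp.congr (by simp) (by simp [hdj])⟩

/-- The queue only ever grows at its end (`l <+: l'`), so positions that have been processed keep
their vertices. -/
theorem searchProg_step (hG : G.InMemory σ) {i₀ b₀ c₀ : ℕ} (hi : i₀ ∈ l)
    (hj : G.succ i₀ b₀ c₀ < G.N) (hb : b₀ < G.k) (hc : c₀ < G.k)
    (h21 : σ.ireg 21 = i₀) (h22 : σ.ireg 22 = b₀) (h23 : σ.ireg 23 = c₀)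
    (hI : G.SearchInv ok E l σ) :
    Does (.seq checkProg pushProg) σ 60 fun σ' => ∃ l', l <+: l' ∧
      G.SearchInv ok (fun i b c => E i b c ∨ (i = i₀ ∧ b = b₀ ∧ c = c₀)) l' σ' := by
  obtain ⟨h24, hF⟩ := checkProg_exec hG (hI.sound _ hi).1 hj h21 h22 h23 hI.flag
  have hf : Frame checkProg σ (checkProg.exec σ) := by
    obtain ⟨t, _, h, -, rfl⟩ := Does.exec (p := checkProg) rfl σ
    exact h.frame
  refine Does.seq_straight (T' := 30) rfl (by decide) (Does.straight rfl (by decide) ?_)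
  generalize checkProg.exec σ = σ₁ at h24 hF hf ⊢
  set j := G.succ i₀ b₀ c₀ with hjdef
  have hF' : Flag σ₁ (ok ∧ ∀ i b c, (E i b c ∨ (i = i₀ ∧ b = b₀ ∧ c = c₀)) →
      G.diag i ∨ ¬ G.diag (G.succ i b c)) := by
    refine hF.congr rfl ⟨?_, ?_⟩
    · rintro ⟨⟨h1, h2⟩, h3⟩
      refine ⟨h1, ?_⟩
      rintro i b c (h | ⟨rfl, rfl, rfl⟩)
      exacts [h2 i b c h, h3]
    · rintro ⟨h1, h2⟩
      exact ⟨⟨h1, fun i b c h => h2 i b c (.inl h)⟩, h2 _ _ _ (.inr ⟨rfl, rfl, rfl⟩)⟩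
  have h20 : σ₁.ireg 20 = l.length := (hf.ireg 20 (by decide)).trans hI.len
  have e6 : σ₁.iarr 6 = σ.iarr 6 := hf.iarr 6 (by decide)
  have e7 : σ₁.iarr 7 = σ.iarr 7 := hf.iarr 7 (by decide)
  by_cases hnew : G.live j ∧ j ∉ l
  · have hv : σ₁.iarr 6 j = 0 := by rw [e6, hI.vis j hj, if_pos hnew]
    have hpush : pushProg.exec σ₁ = ((σ₁.storeI 6 j 1).storeI 7 l.length j).setI 20
        ((l.length : ℤ) + 1) := by
      simp [pushProg, Prog.exec, h24, hv, h20]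
    rw [hpush]
    refine ⟨l ++ [j], List.prefix_append _ _, ?_, ?_, ?_, ?_, ?_, ?_, ?_, ?_⟩
    · exact List.nodup_append.2 ⟨hI.nodup, by simp, by
        rintro a ha b hb rfl; exact hnew.2 (by simpa [List.mem_singleton.1 hb] using ha)⟩
    · simp [hI.zero]
    · intro i hi'
      rcases List.mem_append.1 hi' with h | h
      · exact hI.sound i h
      · obtain rfl : i = j := by simpa using h
        exact ⟨hj, (hI.sound _ hi).2.tail ⟨b₀, hb, c₀, hc, rfl, hnew.1⟩⟩
    · simp
    · intro n hn
      rcases Nat.lt_or_ge n l.length with h | h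
      · have hne : (n : ℤ) ≠ l.length := by exact_mod_cast h.ne
        simp [hne, e7, hI.queue n h, List.getElem_append_left h]
      · obtain rfl : n = l.length := by simp at hn; omega
        simp
    · intro i hiN
      by_cases hij : i = j
      · subst hij; simp
      · have : (i : ℤ) ≠ j := by exact_mod_cast hij
        simp only [State.setI_iarr, State.storeI_iarr, if_neg (show (6 : ℕ) ≠ 7 by decide), if_true,
          Function.update_of_ne this, e6, hI.vis i hiN]
        congr 1
        simp [hij]
    · rintro i b c (h | ⟨rfl, rfl, rfl⟩) hl
      · exact List.mem_append_left _ (hI.closed i b c h hl)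
      · simp [j]
    · exact hF'.congr (by simp) Iff.rfl
  · have hv : σ₁.iarr 6 j = 1 := by rw [e6, hI.vis j hj, if_neg hnew]
    have hpush : pushProg.exec σ₁ = σ₁ := by simp [pushProg, Prog.exec, h24, hv]
    rw [hpush]
    refine ⟨l, List.prefix_rfl, hI.nodup, hI.zero, hI.sound, h20, e7 ▸ hI.queue, e6 ▸ hI.vis,
      ?_, hF'⟩
    rintro i b c (h | ⟨rfl, rfl, rfl⟩) hl
    · exact hI.closed i b c h hl
    · by_contra h
      exact hnew ⟨hl, h⟩

theorem searchProg_spec (hG : G.InMemory σ) (hN : 0 < G.N)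
    (hsucc : ∀ i < G.N, ∀ b < G.k, ∀ c < G.k, G.succ i b c < G.N)
    (hdead : ∀ i < G.N, (G.live i → σ.iarr 6 i = 0) ∧ (¬ G.live i → σ.iarr 6 i = 1))
    (hok : Flag σ ok) :
    Does searchProg σ (G.N * (G.k * (G.k * 69 + 16) + 30) + 20) fun σ' =>
      Flag σ' (ok ∧ G.NoReturn) := by
  refine Does.seq_straight (T' := G.N * (G.k * (G.k * 69 + 16) + 30) + 5) rfl
    (by simp [Prog.cost]; omega) ?_
  -- After `h` rounds the explored edges are those that leave the first `h` entries of the queue.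
  refine (Does.loop (T := G.k * (G.k * 69 + 16) + 20) G.N
    (fun h σ' => σ'.ireg 19 = h ∧ ∃ l, h ≤ l.length ∧
      G.SearchInv ok (fun i b c => i ∈ l.take h ∧ b < G.k ∧ c < G.k) l σ') ?_ ?_).mono
    (by simp [Cond.cost]; ring_nf; omega) ?_
  · refine ⟨by simp [Prog.exec], [0], by simp, by simp, by simp, ?_, by simp [Prog.exec], ?_, ?_,
      by simp, ?_⟩
    · simpa using ⟨hN, .refl⟩
    · simp [Prog.exec]
    · intro i hi
      by_cases hi0 : i = 0
      · subst hi0; simp [Prog.exec]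
      · by_cases hl : G.live i <;> simp [Prog.exec, hi0, hl, hdead i hi]
    · exact hok.congr (by simp [Prog.exec]) (by simp)
  · rintro h σ₁ hf₁ ⟨h19, l, hhl, hI⟩ hb
    have hG₁ : G.InMemory σ₁ := hG.congr ((hf₁.ireg 1 (by decide)).trans (by simp [Prog.exec]))
      ((hf₁.ireg 6 (by decide)).trans (by simp [Prog.exec]))
      ((hf₁.iarr 4 (by decide)).trans (by simp [Prog.exec]))
      ((hf₁.iarr 5 (by decide)).trans (by simp [Prog.exec]))
    have hlt : h < l.length := by simpa [h19, hI.len, Int.add_one_le_iff] using hb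
    refine ⟨hlt.trans_le hI.length_le, ?_⟩
    refine Does.seq_straight (T' := G.k * (G.k * 69 + 16) + 7) rfl
      (by simp [Prog.cost]; omega) ?_
    set i₀ := l[h] with hi₀
    have hmem : i₀ ∈ l := List.getElem_mem hlt
    have hexec : Prog.exec (.seq (.setI 21 (.load 7 (.reg 19)))
        (.setI 19 (.add (.reg 19) (.const 1)))) σ₁ = (σ₁.setI 21 i₀).setI 19 ((h : ℤ) + 1) := by
      simp [Prog.exec, h19, hI.queue h hlt, hi₀]
    rw [hexec]
    have hInv₀ : G.SearchInv ok (fun i b c => i ∈ l.take h ∧ b < G.k ∧ c < G.k) l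
        ((σ₁.setI 21 i₀).setI 19 ((h : ℤ) + 1)) :=
      hI.congr (fun _ _ _ => Iff.rfl) (by simp) (by simp) (by simp) (by simp)
    have hG₂ : G.InMemory ((σ₁.setI 21 i₀).setI 19 ((h : ℤ) + 1)) :=
      hG₁.congr (by simp) (by simp) (by simp) (by simp)
    have h21 : ((σ₁.setI 21 i₀).setI 19 ((h : ℤ) + 1)).ireg 21 = i₀ := by simp
    have h19' : ((σ₁.setI 21 i₀).setI 19 ((h : ℤ) + 1)).ireg 19 = (h : ℤ) + 1 := by simp
    generalize (σ₁.setI 21 i₀).setI 19 ((h : ℤ) + 1) = σ₂ at hInv₀ hG₂ h21 h19' ⊢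
    refine (Does.count (T := G.k * 69 + 7) G.k hG₂.k (by decide) (by decide) (by decide)
      (fun b₀ σ' => ∃ l', l <+: l' ∧ G.SearchInv ok (fun i b c => i ∈ l.take h ∧ b < G.k ∧ c < G.k
        ∨ i = i₀ ∧ b < b₀ ∧ c < G.k) l' σ') ?_ ?_).mono (by ring_nf; rfl) ?_
    · exact ⟨l, List.prefix_rfl, hInv₀.congr (by simp) (by simp) (by simp) (by simp) (by simp)⟩
    · rintro b₀ σ₃ hb₀ hf₃ h22 ⟨l₃, hl₃, hI₃⟩
      have hG₃ : G.InMemory σ₃ := hG₂.congr (hf₃.ireg 1 (by decide)) (hf₃.ireg 6 (by decide))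
        (hf₃.iarr 4 (by decide)) (hf₃.iarr 5 (by decide))
      refine (Does.count (T := 60) G.k hG₃.k (by decide) (by decide) (by decide)
        (fun c₀ σ' => ∃ l', l <+: l' ∧ G.SearchInv ok (fun i b c =>
          (i ∈ l.take h ∧ b < G.k ∧ c < G.k ∨ i = i₀ ∧ b < b₀ ∧ c < G.k)
            ∨ i = i₀ ∧ b = b₀ ∧ c < c₀) l' σ') ?_ ?_).mono (by ring_nf; rfl) ?_
      · exact ⟨l₃, hl₃, hI₃.congr (by simp) (by simp) (by simp) (by simp) (by simp)⟩
      · rintro c₀ σ₄ hc₀ hf₄ h23 ⟨l₄, hl₄, hI₄⟩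
        have hG₄ : G.InMemory σ₄ := hG₃.congr (hf₄.ireg 1 (by decide)) (hf₄.ireg 6 (by decide))
          (hf₄.iarr 4 (by decide)) (hf₄.iarr 5 (by decide))
        have hmem₄ : i₀ ∈ l₄ := hl₄.subset hmem
        refine (searchProg_step hG₄ hmem₄ (hsucc _ (hI₄.sound _ hmem₄).1 _ hb₀ _ hc₀) hb₀ hc₀
          ((hf₄.ireg 21 (by decide)).trans ((hf₃.ireg 21 (by decide)).trans h21))
          ((hf₄.ireg 22 (by decide)).trans h22) h23 hI₄).mono le_rfl ?_
        rintro σ₅ ⟨l₅, hl₅, hI₅⟩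
        refine ⟨l₅, hl₄.trans hl₅, hI₅.congr (fun i b c => ?_) (by simp) (by simp) (by simp)
          (by simp)⟩
        rw [or_assoc, Nat.lt_succ_iff_lt_or_eq]
        tauto
      · rintro σ₄ ⟨-, l₄, hl₄, hI₄⟩
        refine ⟨l₄, hl₄, hI₄.congr (fun i b c => ?_) (by simp) (by simp) (by simp) (by simp)⟩
        rw [or_assoc, Nat.lt_succ_iff_lt_or_eq]
        tauto
    · rintro σ₃ ⟨hf₃, l₃, hl₃, hI₃⟩
      refine ⟨(hf₃.ireg 19 (by decide)).trans (by rw [h19']; simp), l₃,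
        hlt.trans_le hl₃.length_le, hI₃.congr (fun i b c => ?_) rfl rfl rfl rfl⟩
      have : l₃.take (h + 1) = l.take h ++ [i₀] := by
        obtain ⟨l', rfl⟩ := hl₃
        rw [List.take_append_of_le_length hlt, List.take_succ_eq_append_getElem hlt]
      rw [this]
      simp only [List.mem_append, List.mem_singleton]
      tauto
  · rintro σ₁ ⟨-, hb, h, -, h19, l, hhl, hI⟩
    have hlen : h = l.length := by
      have : ¬ h < l.length := by simpa [h19, hI.len, Int.add_one_le_iff] using hb
      omega
    subst hlen
    simp only [List.take_length] at hI
    -- A queue that has been processed completely is closed under live edges and contains 0.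
    have hmem : ∀ i, G.Reach i → i ∈ l := by
      intro i hi
      induction hi with
      | refl => exact hI.zero
      | tail _ h ih =>
        obtain ⟨b, hb, c, hc, rfl, hl⟩ := h
        exact hI.closed _ _ _ ⟨ih, hb, hc⟩ hl
    refine hI.flag.congr rfl (and_congr Iff.rfl ⟨?_, ?_⟩)
    · exact fun h i hi b hb c hc => h i b c ⟨hmem i hi, hb, hc⟩
    · exact fun h i b c hE => h i (hI.sound i hE.1).2 b hE.2.1 c hE.2.2

end SearchGraph

end AlgRAM

/-! ### Well-formedness means that the columns are orthonormal -/

namespace LQCA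

open scoped InnerProductSpace

variable {Q : Type*} [Fintype Q] (A : LQCA Q)

/-- The argument of the local transition function at the cell `i`. -/
def window (c : A.Config) (i : ℤ) : Fin A.r → Q := fun j => c.1 (i + A.nbr j)

theorem exists_finset_window (c c' : A.Config) :
    ∃ I : Finset ℤ, ∀ i ∉ I, A.window c i = (fun _ => A.q) ∧ A.window c' i = (fun _ => A.q) := by
  classical
  refine ⟨Finset.univ.biUnion fun j => (c.2.toFinset ∪ c'.2.toFinset).image fun i => i - A.nbr j,
    fun i hi => ?_⟩
  simp only [Finset.mem_biUnion, Finset.mem_univ, true_and, Finset.mem_image, Finset.mem_union,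
    Set.Finite.mem_toFinset, Set.mem_ofPred_eq, not_exists, not_and] at hi
  constructor <;> funext j <;> by_contra h
  · exact hi j (i + A.nbr j) (.inl h) (by ring)
  · exact hi j (i + A.nbr j) (.inr h) (by ring)

variable {A}

theorem U_eq_prod {I : Finset ℤ} {c d : A.Config} (hI : ∀ i ∉ I, A.window c i = fun _ => A.q)
    (hd : ∀ i ∉ I, d.1 i = A.q) : A.U d c = ∏ i ∈ I, A.δ (A.window c i) (d.1 i) := by
  refine finprod_eq_prod_of_mulSupport_subset _ fun i hi => ?_
  by_contra h
  refine hi ?_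
  change A.δ (A.window c i) (d.1 i) = 1
  rw [hI i h, hd i h, A.δ_quiescent_self]

theorem U_eq_zero {I : Finset ℤ} {c d : A.Config} (hI : ∀ i ∉ I, A.window c i = fun _ => A.q)
    {i : ℤ} (hi : i ∉ I) (hd : d.1 i ≠ A.q) : A.U d c = 0 := by
  classical
  have hsupp : A.U d c = ∏ i ∈ I ∪ d.2.toFinset, A.δ (A.window c i) (d.1 i) := by
    refine finprod_eq_prod_of_mulSupport_subset _ fun i hi => ?_
    by_contra h
    simp only [Finset.coe_union, Set.Finite.coe_toFinset, Set.mem_union, Finset.mem_coe,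
      Set.mem_ofPred_eq, not_or, not_not] at h
    refine hi ?_
    change A.δ (A.window c i) (d.1 i) = 1
    rw [hI i h.1, h.2, A.δ_quiescent_self]
  rw [hsupp]
  refine Finset.prod_eq_zero (i := i) (by simp [hd]) ?_
  rw [hI i hi, A.δ_quiescent_ne _ hd]

variable (A) in
open Classical in
/-- The configuration with given states in a finite set of cells. -/
noncomputable def extend (I : Finset ℤ) (g : I → Q) : A.Config :=
  ⟨fun i => if h : i ∈ I then g ⟨i, h⟩ else A.q, I.finite_toSet.subset fun i hi => by
    by_contra h
    exact hi (dif_neg h)⟩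

theorem extend_injective (I : Finset ℤ) : Function.Injective (A.extend I) := by
  intro g g' h
  funext i
  have := congrFun (congrArg Subtype.val h) i
  simpa [extend] using this

theorem mem_range_extend {I : Finset ℤ} {d : A.Config} (hd : ∀ i ∉ I, d.1 i = A.q) :
    d ∈ Set.range (A.extend I) := by
  refine ⟨fun i => d.1 i, Subtype.ext (funext fun i => ?_)⟩
  by_cases h : i ∈ I
  · simp [extend, h]
  · simp [extend, h, hd i h]

/-- Off a finite set `I` of cells both windows are quiescent, so only the finitely many `d` that are
quiescent off `I` contribute. Their sum of products over `I` is, by distributivity, a product of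
sums over single states, which are inner products in `ℂ^Q`. -/
theorem hasSum_columns (c c' : A.Config) :
    HasSum (fun d => star (A.U d c) * A.U d c')
      (∏ᶠ i, ⟪A.δ (A.window c i), A.δ (A.window c' i)⟫_ℂ) := by
  classical
  obtain ⟨I, hI⟩ := A.exists_finset_window c c'
  have h1 : ∏ᶠ i, ⟪A.δ (A.window c i), A.δ (A.window c' i)⟫_ℂ =
      ∏ i ∈ I, ⟪A.δ (A.window c i), A.δ (A.window c' i)⟫_ℂ := by
    refine finprod_eq_prod_of_mulSupport_subset _ fun i hi => ?_
    by_contra h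
    refine hi ?_
    simp only [(hI i h).1, (hI i h).2, PiLp.inner_apply]
    rw [Finset.sum_eq_single A.q]
    · simp [A.δ_quiescent_self]
    · intro y _ hy
      simp [A.δ_quiescent_ne y hy]
    · simp
  have h2 : ∏ i ∈ I, ⟪A.δ (A.window c i), A.δ (A.window c' i)⟫_ℂ =
      ∑ g : I → Q, star (A.U (A.extend I g) c) * A.U (A.extend I g) c' := by
    rw [← Finset.prod_coe_sort]
    simp only [PiLp.inner_apply]
    rw [Finset.prod_univ_sum, Fintype.piFinset_univ]
    refine Finset.sum_congr rfl fun g _ => ?_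
    rw [U_eq_prod (I := I) (fun i hi => (hI i hi).1) (fun i hi => by simp [extend, hi]),
      U_eq_prod (I := I) (fun i hi => (hI i hi).2) (fun i hi => by simp [extend, hi]),
      star_prod, ← Finset.prod_mul_distrib, ← Finset.prod_coe_sort I]
    refine Finset.prod_congr rfl fun i _ => ?_
    simp [extend, mul_comm]
  rw [h1, h2]
  refine ((extend_injective I).hasSum_iff fun d hd => ?_).1 (hasSum_fintype _)
  by_cases h : ∀ i ∉ I, d.1 i = A.q
  · exact absurd (mem_range_extend h) hd
  · push Not at h
    obtain ⟨i, hi, hdi⟩ := h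
    rw [U_eq_zero (fun i hi => (hI i hi).1) hi hdi]
    simp

variable (A) in
/-- The columns of the time evolution matrix. -/
noncomputable def column (c : A.Config) : lp (fun _ : A.Config => ℂ) 2 :=
  ⟨fun d => A.U d c, memℓp_gen <| by
    have := (hasSum_columns c c).summable.norm
    refine this.congr fun d => ?_
    simp [sq]⟩

theorem column_apply (c d : A.Config) : A.column c d = A.U d c := rfl

theorem inner_column (c c' : A.Config) : ⟪A.column c, A.column c'⟫_ℂ =
    ∏ᶠ i, ⟪A.δ (A.window c i), A.δ (A.window c' i)⟫_ℂ := by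
  refine HasSum.unique (lp.hasSum_inner _ _) ?_
  have e : (fun d => ⟪A.column c d, A.column c' d⟫_ℂ) = fun d => star (A.U d c) * A.U d c' :=
    funext fun d => by simp [column_apply, mul_comm]
  rw [e]
  exact hasSum_columns c c'

/-- Coordinates of the image are unique limits, so the image of a vector supported on two
configurations is the same combination of columns. -/
theorem WellFormed.norm_column_add (h : A.WellFormed) [DecidableEq A.Config] {c c' : A.Config}
    (hc : c ≠ c') (z : ℂ) : ‖A.column c + z • A.column c'‖ =
      ‖(lp.single 2 c 1 + z • lp.single 2 c' 1 : lp (fun _ : A.Config => ℂ) 2)‖ := by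
  obtain ⟨v, hv, hn⟩ := h (lp.single 2 c 1 + z • lp.single 2 c' 1)
  rw [← hn]
  congr 1
  refine lp.ext (funext fun d => ?_)
  have hu : ∀ b, (lp.single 2 c 1 + z • lp.single 2 c' 1 : lp (fun _ : A.Config => ℂ) 2) b =
      Pi.single (M := fun _ => ℂ) c 1 b + z * Pi.single (M := fun _ => ℂ) c' 1 b := fun b => rfl
  have hcol : (A.column c + z • A.column c' : lp (fun _ : A.Config => ℂ) 2) d =
      A.U d c + z * A.U d c' := rfl
  refine HasSum.unique (?_ : HasSum _ _) (hv d)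
  have := hasSum_sum_of_ne_finset_zero (L := SummationFilter.unconditional A.Config)
    (s := {c, c'}) (f := fun b => A.U d b *
    (lp.single 2 c 1 + z • lp.single 2 c' 1 : lp (fun _ : A.Config => ℂ) 2) b) (fun b hb => by
      simp only [Finset.mem_insert, Finset.mem_singleton, not_or] at hb
      simp [hu, hb.1, hb.2])
  rw [Finset.sum_pair hc] at this
  rw [hcol]
  simpa [hu, hc, hc.symm, mul_comm] using this

theorem wellFormed_iff_orthonormal : A.WellFormed ↔ Orthonormal ℂ A.column := by
  classical
  constructor
  · intro h
    have h1 : ∀ c, ‖A.column c‖ = 1 := by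
      intro c
      obtain ⟨v, hv, hn⟩ := h (lp.single 2 c 1)
      have : A.column c = v := by
        refine lp.ext (funext fun d => HasSum.unique (?_ : HasSum _ _) (hv d))
        convert hasSum_single c (f := fun b => A.U d b *
          (lp.single 2 c 1 : lp (fun _ : A.Config => ℂ) 2) b) ?_ using 1
        · simp [column_apply]
        · intro b hb
          simp [lp.single_apply, hb]
      rw [this, hn, lp.norm_single (by norm_num)]
      simp
    refine ⟨h1, fun c c' hc => ?_⟩
    -- Let w be the inner product of the columns. With its conjugate as coefficient the squared
    -- norms are 1 + 2|w|² + |w|² and 1 + |w|², whence w = 0; one coefficient suffices.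
    have h2 := congrArg (· ^ 2) (h.norm_column_add hc (star ⟪A.column c, A.column c'⟫_ℂ))
    simp only [@norm_add_sq ℂ, inner_smul_right, norm_smul, h1, lp.inner_single_left] at h2
    simp only [lp.single_apply, Pi.single_apply, hc, if_false,
      lp.norm_single (show (0 : ENNReal) < 2 by norm_num)] at h2
    change ⟪A.column c, A.column c'⟫_ℂ = 0
    generalize ⟪A.column c, A.column c'⟫_ℂ = w at h2 ⊢
    have h3 : w.re * w.re + w.im * w.im = 0 := by simpa using h2
    exact Complex.normSq_eq_zero.1 h3
  · intro h u
    -- The isometry maps `u` to the sum of the `u c • column c`; evaluation at `d` is continuous and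
    -- may be applied termwise.
    refine ⟨h.orthogonalFamily.linearIsometry u, fun d => ?_, LinearIsometry.norm_map _ _⟩
    have := (h.orthogonalFamily.hasSum_linearIsometry u).mapL (lp.evalCLM ℂ (fun _ => ℂ) 2 d)
    have e : (fun c => A.U d c * u c) = fun c => lp.evalCLM ℂ (fun _ => ℂ) 2 d
        (LinearIsometry.toSpanSingleton ℂ _ (h.1 c) (u c)) :=
      funext fun c => mul_comm _ _
    rw [e]
    exact this

theorem wellFormed_iff_inner : A.WellFormed ↔
    (∀ c : A.Config, ∏ᶠ i, ⟪A.δ (A.window c i), A.δ (A.window c i)⟫_ℂ = 1) ∧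
    ∀ c c' : A.Config, c ≠ c' → ∏ᶠ i, ⟪A.δ (A.window c i), A.δ (A.window c' i)⟫_ℂ = 0 := by
  rw [wellFormed_iff_orthonormal]
  simp only [← inner_column]
  refine and_congr (forall_congr' fun c => ?_) Iff.rfl
  rw [inner_self_eq_norm_sq_to_K]
  rw [← RCLike.ofReal_pow, ← RCLike.ofReal_one (K := ℂ), RCLike.ofReal_inj]
  exact (pow_eq_one_iff_of_nonneg (norm_nonneg (A.column c)) two_ne_zero).symm

end LQCA

/-! ### Walks in the graph of pairs of words -/

namespace DeBruijn

open AlgRAM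

variable {k : ℕ} (K : ℕ) (g : ℕ → ℕ → ℂ)

/-- The pair of words that arises if a pair of letters is appended. -/
def edge (p : ℕ × ℕ) (a : Fin k × Fin k) : ℕ × ℕ := (p.1 * k + a.1, p.2 * k + a.2)

/-- The pair of words without their first letters. -/
def red (p : ℕ × ℕ) : ℕ × ℕ := (p.1 % K, p.2 % K)

/-- The endpoint of a walk. -/
def endpoint (p : ℕ × ℕ) (l : List (Fin k × Fin k)) : ℕ × ℕ :=
  l.foldl (fun p a => red K (edge p a)) p

/-- The weight of a walk. -/
def weight : ℕ × ℕ → List (Fin k × Fin k) → ℂ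
  | _, [] => 1
  | p, a :: l => g (edge p a).1 (edge p a).2 * weight (red K (edge p a)) l

/-- The letters of the pairs are equal. -/
def IsDiag (l : List (Fin k × Fin k)) : Prop := ∀ a ∈ l, a.1 = a.2

theorem endpoint_append (p : ℕ × ℕ) (l l' : List (Fin k × Fin k)) :
    endpoint K p (l ++ l') = endpoint K (endpoint K p l) l' := List.foldl_append

theorem weight_append (p : ℕ × ℕ) (l l' : List (Fin k × Fin k)) :
    weight K g p (l ++ l') = weight K g p l * weight K g (endpoint K p l) l' := by
  induction l generalizing p with
  | nil => simp [weight, endpoint]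
  | cons a l ih => simp [weight, ih, endpoint, mul_assoc]

theorem endpoint_concat (p : ℕ × ℕ) (l : List (Fin k × Fin k)) (a : Fin k × Fin k) :
    endpoint K p (l ++ [a]) = red K (edge (endpoint K p l) a) := endpoint_append ..

theorem weight_concat (p : ℕ × ℕ) (l : List (Fin k × Fin k)) (a : Fin k × Fin k) :
    weight K g p (l ++ [a]) =
      weight K g p l * g (edge (endpoint K p l) a).1 (edge (endpoint K p l) a).2 := by
  simp [weight_append, weight]

variable {K g}

theorem IsDiag.append {l l' : List (Fin k × Fin k)} (h : IsDiag l) (h' : IsDiag l') :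
    IsDiag (l ++ l') := fun a ha => (List.mem_append.1 ha).elim (h a) (h' a)

theorem isDiag_singleton (a : Fin k) : IsDiag [(a, a)] := fun b hb => by
  obtain rfl := List.mem_singleton.1 hb; rfl

/-- Strong connectivity of the diagonal: writing enough zeros erases `v`, after which the digits of
`u` are written, the leading one first. -/
theorem exists_walk {n : ℕ} (hk : 2 ≤ k) (v : ℕ) {u : ℕ} (hu : u < k ^ n) :
    ∃ l : List (Fin k × Fin k), IsDiag l ∧ endpoint (k ^ n) (v, v) l = (u, u) := by
  induction u using Nat.strong_induction_on with
  | _ u ih =>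
    rcases Nat.eq_zero_or_pos u with rfl | hu0
    -- At least one letter is read, because `v` need not be below `k ^ n` and only reading a letter
    -- reduces it.
    · have key : ∀ m, ∃ l : List (Fin k × Fin k), IsDiag l ∧
          endpoint (k ^ n) (v, v) l = (v * k ^ (m + 1) % k ^ n, v * k ^ (m + 1) % k ^ n) := by
        intro m
        induction m with
        | zero =>
          refine ⟨[(⟨0, by omega⟩, ⟨0, by omega⟩)], isDiag_singleton _, ?_⟩
          simp [endpoint, edge, red]
        | succ m ih =>
          obtain ⟨l, hl, he⟩ := ih
          refine ⟨l ++ [(⟨0, by omega⟩, ⟨0, by omega⟩)], hl.append (isDiag_singleton _), ?_⟩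
          rw [endpoint_concat, he]
          simp [red, edge, pow_succ, ← mul_assoc]
      obtain ⟨l, hl, h⟩ := key n
      refine ⟨l, hl, ?_⟩
      rw [h, pow_succ, mul_left_comm, Nat.mul_mod_right]
    · have hlt := Nat.div_lt_self hu0 hk
      obtain ⟨l, hl, he⟩ := ih (u / k) hlt (hlt.trans hu)
      refine ⟨l ++ [(⟨u % k, Nat.mod_lt _ (by omega)⟩, ⟨u % k, Nat.mod_lt _ (by omega)⟩)],
        hl.append (isDiag_singleton _), ?_⟩
      simp [endpoint_concat, he, edge, red, Nat.div_add_mod', Nat.mod_eq_of_lt hu]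

theorem endpoint_diag {l : List (Fin k × Fin k)} (hl : IsDiag l) {v : ℕ} (hv : v < K) :
    ∃ u < K, endpoint K (v, v) l = (u, u) := by
  induction l generalizing v with
  | nil => exact ⟨v, hv, rfl⟩
  | cons a l ih =>
    have ha : a.1 = a.2 := hl a (by simp)
    obtain ⟨u, hu, h⟩ := ih (fun b hb => hl b (by simp [hb]))
      (Nat.mod_lt (v * k + a.1) (by omega : 0 < K))
    exact ⟨u, hu, by rw [← h]; simp [endpoint, red, edge, ha]⟩

theorem edge_fst_lt {v b : ℕ} (hv : v < K) (hb : b < k) : v * k + b < K * k := by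
  calc v * k + b < v * k + k := by omega
    _ = (v + 1) * k := by ring
    _ ≤ K * k := Nat.mul_le_mul_right _ hv

theorem weight_diag_ne_zero (hg : ∀ x < K * k, g x x ≠ 0) {l : List (Fin k × Fin k)}
    (hl : IsDiag l) {v : ℕ} (hv : v < K) : weight K g (v, v) l ≠ 0 := by
  induction l generalizing v with
  | nil => simp [weight]
  | cons a l ih =>
    have ha : a.1 = a.2 := hl a (by simp)
    have := ih (fun b hb => hl b (by simp [hb])) (Nat.mod_lt (v * k + a.1) (by omega : 0 < K))
    simp only [weight, red, edge, ← ha]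
    exact mul_ne_zero (hg _ (edge_fst_lt hv a.1.2)) this

/-! ### Closed diagonal walks and potentials -/

section Potential

variable {w : ℕ → ℂ}

theorem potential_ne_zero {M : ℕ} (hw : ∀ x < M, w x ≠ 0) {x : ℕ} (hx : x < M) :
    potential k w x ≠ 0 := by
  induction x using Nat.strong_induction_on with
  | _ x ih =>
    rw [potential]
    split_ifs with h
    · exact mul_ne_zero (ih _ h (h.trans hx)) (hw x hx)
    · exact one_ne_zero

theorem potential_endpoint (hw : IsPotential k K (K * k) fun x => g x x)
    {l : List (Fin k × Fin k)} (hl : IsDiag l) {v : ℕ} (hv : v < K) :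
    potential k (fun x => g x x) (endpoint K (v, v) l).1 =
      potential k (fun x => g x x) v * weight K g (v, v) l := by
  induction l generalizing v with
  | nil => simp [endpoint, weight]
  | cons a l ih =>
    have ha : a.1 = a.2 := hl a (by simp)
    have := ih (fun b hb => hl b (by simp [hb])) (Nat.mod_lt (v * k + a.1) (by omega : 0 < K))
    have hpot := hw (v * k + a.1) (edge_fst_lt hv a.1.2)
    have hk : 0 < k := a.1.pos
    rw [hpot, mul_comm v k, Nat.mul_add_div hk, Nat.div_eq_of_lt a.1.2, add_zero, mul_comm k v]
      at this
    simp only [endpoint, List.foldl_cons, weight, red, edge, ← ha] at this ⊢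
    rw [this, mul_assoc]

/-- A potential telescopes along a closed walk and cancels, being nonzero. Conversely, let ψ be the
weight of a chosen path from `z` to each vertex. The chosen path to `x % k ^ n` and the one to `x /
k` prolonged by the edge `x` are closed up by the same return path, so ψ is multiplied by `g x x`
along `x`. Induction along the tree in which `v / k` is the parent of `v` shows that ψ is a nonzero
multiple of `potential`. -/
theorem isPotential_iff {n : ℕ} (hk : 2 ≤ k) (hg : ∀ x < k ^ n * k, g x x ≠ 0) {z : ℕ}
    (hz : z < k ^ n) : IsPotential k (k ^ n) (k ^ n * k) (fun x => g x x) ↔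
      ∀ l : List (Fin k × Fin k), IsDiag l → endpoint (k ^ n) (z, z) l = (z, z) →
        weight (k ^ n) g (z, z) l = 1 := by
  have hKM : k ^ n ≤ k ^ n * k := Nat.le_mul_of_pos_right _ (by omega)
  constructor
  · intro h l hl he
    have h1 := potential_endpoint h hl hz
    rw [he] at h1
    exact (mul_eq_left₀ (potential_ne_zero hg (hz.trans_le hKM))).1 h1.symm
  · intro h
    have hto : ∀ v : ℕ, ∃ l : List (Fin k × Fin k), v < k ^ n →
        IsDiag l ∧ endpoint (k ^ n) (z, z) l = (v, v) := fun v => by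
      by_cases hv : v < k ^ n
      · obtain ⟨l, hl⟩ := exists_walk hk z hv
        exact ⟨l, fun _ => hl⟩
      · exact ⟨[], fun h => absurd h hv⟩
    choose path hto using hto
    set ψ : ℕ → ℂ := fun v => weight (k ^ n) g (z, z) (path v) with hψ
    have hstep : ∀ x < k ^ n * k, ψ (x % k ^ n) = ψ (x / k) * g x x ∧ ψ (x / k) ≠ 0 := by
      intro x hx
      have hdiv : x / k < k ^ n := Nat.div_lt_of_lt_mul (by rwa [mul_comm])
      have hmod : x % k ^ n < k ^ n := Nat.mod_lt _ (by positivity)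
      obtain ⟨h1, e1⟩ := hto _ hdiv
      obtain ⟨h2, e2⟩ := hto _ hmod
      obtain ⟨l, hl, he⟩ := exists_walk hk (x % k ^ n) hz
      set a : Fin k := ⟨x % k, Nat.mod_lt _ (by omega)⟩ with ha
      have hedge : edge (x / k, x / k) (a, a) = (x, x) := by
        simp [edge, ha, Nat.div_add_mod']
      have hend : endpoint (k ^ n) (z, z) (path (x / k) ++ [(a, a)]) = (x % k ^ n, x % k ^ n) := by
        rw [endpoint_concat, e1, hedge]; rfl
      have p1 := h (path (x / k) ++ [(a, a)] ++ l) ((h1.append (isDiag_singleton a)).append hl)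
        (by rw [endpoint_append, hend, he])
      have p2 := h (path (x % k ^ n) ++ l) (h2.append hl) (by rw [endpoint_append, e2, he])
      rw [weight_append, hend, weight_concat, e1, hedge] at p1
      rw [weight_append, e2] at p2
      have hne : weight (k ^ n) g (x % k ^ n, x % k ^ n) l ≠ 0 := by
        intro h0; rw [h0, mul_zero] at p2; exact zero_ne_one p2
      refine ⟨mul_right_cancel₀ hne (p2.trans p1.symm), ?_⟩
      intro h0
      change weight _ _ _ _ = 0 at h0
      rw [h0, zero_mul, zero_mul] at p1
      exact zero_ne_one p1
    have hψ0 : ψ 0 ≠ 0 := by simpa using (hstep 0 (by positivity)).2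
    have hpot : ∀ v < k ^ n, ψ v = ψ 0 * potential k (fun x => g x x) v := by
      intro v
      induction v using Nat.strong_induction_on with
      | _ v ih =>
        intro hv
        rw [potential]
        rcases Nat.eq_zero_or_pos v with rfl | hv0
        · simp
        · have hlt := Nat.div_lt_self hv0 hk
          have := (hstep v (hv.trans_le hKM)).1
          rw [Nat.mod_eq_of_lt hv, ih _ hlt (hlt.trans hv)] at this
          rw [if_pos hlt, this, mul_assoc]
    intro x hx
    have := (hstep x hx).1
    rw [hpot _ (Nat.mod_lt _ (by positivity)),
      hpot _ (Nat.div_lt_of_lt_mul (by rwa [mul_comm])), mul_assoc] at this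
    exact mul_left_cancel₀ hψ0 this

end Potential

/-! ### Closed walks off the diagonal and reachability -/

section Return

/-- The pairs of words that can be reached from the pair of the words `0`. -/
def PairReach (k K : ℕ) (g : ℕ → ℕ → ℂ) : ℕ × ℕ → Prop :=
  Relation.ReflTransGen (fun p p' => ∃ a : Fin k × Fin k, p' = edge (red K p) a ∧ g p'.1 p'.2 ≠ 0)
    (0, 0)

/-- No off-diagonal pair that can be reached has a diagonal successor. -/
def NoReturn (k K : ℕ) (g : ℕ → ℕ → ℂ) : Prop :=
  ∀ p, PairReach k K g p → ∀ a : Fin k × Fin k,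
    p.1 = p.2 ∨ (edge (red K p) a).1 ≠ (edge (red K p) a).2

theorem pairReach_diag {n : ℕ} (hk : 2 ≤ k) (hg : ∀ x < k ^ n * k, g x x ≠ 0) {x : ℕ}
    (hx : x < k ^ n * k) : PairReach k (k ^ n) g (x, x) := by
  induction x using Nat.strong_induction_on with
  | _ x ih =>
    rcases Nat.eq_zero_or_pos x with rfl | hx0
    · exact .refl
    · have hlt := Nat.div_lt_self hx0 hk
      have hdiv : x / k < k ^ n := Nat.div_lt_of_lt_mul (by rwa [mul_comm])
      refine (ih _ hlt (hlt.trans hx)).tail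
        ⟨(⟨x % k, Nat.mod_lt _ (by omega)⟩, ⟨x % k, Nat.mod_lt _ (by omega)⟩), ?_, hg x hx⟩
      simp [edge, red, Nat.mod_eq_of_lt hdiv, Nat.div_add_mod']

/-- Equal words followed by equal letters remain equal, so along a diagonal walk an inequality in
`p` could be traced back to the pair `(0, 0)`. -/
theorem exists_walk_of_pairReach {n : ℕ} (hk : 2 ≤ k) (hg : ∀ x < k ^ n * k, g x x ≠ 0) {z : ℕ}
    (hz : z < k ^ n) {p : ℕ × ℕ} (hp : PairReach k (k ^ n) g p) :
    ∃ l : List (Fin k × Fin k), endpoint (k ^ n) (z, z) l = red (k ^ n) p ∧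
      weight (k ^ n) g (z, z) l ≠ 0 ∧ (p.1 ≠ p.2 → ¬ IsDiag l) := by
  induction hp with
  | refl =>
    obtain ⟨l, hl, he⟩ := exists_walk hk z (u := 0) (n := n) (by positivity)
    refine ⟨l, by simpa [red] using he, ?_, by simp⟩
    exact weight_diag_ne_zero hg hl hz
  | tail _ h ih =>
    obtain ⟨a, rfl, hne⟩ := h
    obtain ⟨l, he, hw, hd⟩ := ih
    refine ⟨l ++ [a], by rw [endpoint_concat, he], ?_, ?_⟩
    · rw [weight_concat, he]
      exact mul_ne_zero hw hne
    · intro h hdiag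
      refine hd ?_ fun b hb => hdiag b (by simp [hb])
      intro h'
      apply h
      simp [edge, red, h', hdiag a (by simp)]

/-- Once a walk of nonzero weight has left the diagonal, `NoReturn` keeps its edges off it. The edge
`p` is recorded rather than its endpoint, since words that differ only in the first letter have
equal reductions. -/
theorem diag_or_pairReach {n : ℕ} (hk : 2 ≤ k) (hg : ∀ x < k ^ n * k, g x x ≠ 0) {z : ℕ}
    (hz : z < k ^ n) (hN : NoReturn k (k ^ n) g) (l : List (Fin k × Fin k))
    (hw : weight (k ^ n) g (z, z) l ≠ 0) : IsDiag l ∨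
      ∃ p : ℕ × ℕ, p.1 ≠ p.2 ∧ PairReach k (k ^ n) g p ∧
        endpoint (k ^ n) (z, z) l = red (k ^ n) p := by
  induction l using List.reverseRecOn with
  | nil => exact .inl (by simp [IsDiag])
  | append_singleton l a ih =>
    rw [weight_concat] at hw
    rcases ih (left_ne_zero_of_mul hw) with hl | ⟨p, hp, hr, he⟩
    · by_cases ha : a.1 = a.2
      · exact .inl (hl.append fun b hb => by rwa [List.mem_singleton.1 hb])
      · right
        obtain ⟨u, hu, he⟩ := endpoint_diag hl hz
        rw [he] at hw
        refine ⟨edge (u, u) a, ?_, ?_, by rw [endpoint_concat, he]⟩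
        · simpa [edge, Fin.ext_iff] using ha
        · refine (pairReach_diag hk hg (hu.trans_le (Nat.le_mul_of_pos_right _ (by omega)))).tail
            ⟨a, by simp [red, Nat.mod_eq_of_lt hu], right_ne_zero_of_mul hw⟩
    · right
      rw [he] at hw
      exact ⟨_, (hN p hr a).resolve_left hp, hr.tail ⟨a, rfl, right_ne_zero_of_mul hw⟩,
        by rw [endpoint_concat, he]⟩

/-- If a closed walk ended with an off-diagonal edge, any two equal letters would prolong it by a
diagonal one, against `NoReturn`. Conversely, a return can be completed within the diagonal, where
all entries are nonzero, to a closed walk of nonzero weight. For the same reason the diagonal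
successor need not be required to be live. -/
theorem noReturn_iff {n : ℕ} (hk : 2 ≤ k) (hg : ∀ x < k ^ n * k, g x x ≠ 0) {z : ℕ}
    (hz : z < k ^ n) : NoReturn k (k ^ n) g ↔
      ∀ l : List (Fin k × Fin k), ¬ IsDiag l → endpoint (k ^ n) (z, z) l = (z, z) →
        weight (k ^ n) g (z, z) l = 0 := by
  constructor
  · intro hN l hl he
    by_contra hw
    obtain ⟨p, hp, hr, he'⟩ := (diag_or_pairReach hk hg hz hN l hw).resolve_left hl
    rw [he] at he'
    refine (hN p hr (⟨0, by omega⟩, ⟨0, by omega⟩)).elim hp fun h => h ?_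
    simp [← he', edge]
  · intro h p hr a
    by_contra hc
    push Not at hc
    obtain ⟨hp, ha⟩ := hc
    obtain ⟨l, he, hw, hd⟩ := exists_walk_of_pairReach hk hg hz hr
    set x := (edge (red (k ^ n) p) a).1 with hx
    have hxM : x < k ^ n * k := edge_fst_lt (Nat.mod_lt _ (by positivity)) a.1.2
    obtain ⟨l', hl', he'⟩ := exists_walk hk (x % k ^ n) hz
    have hend : endpoint (k ^ n) (z, z) (l ++ [a]) = (x % k ^ n, x % k ^ n) := by
      rw [endpoint_concat, he, red, ← ha, ← hx]
    have := h (l ++ [a] ++ l') (fun hdiag => hd hp fun b hb => hdiag b (by simp [hb]))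
      (by rw [endpoint_append, hend, he'])
    rw [weight_append, weight_concat, hend, he, ← ha, ← hx] at this
    exact mul_ne_zero (mul_ne_zero hw (hg x hxM))
      (weight_diag_ne_zero hg hl' (Nat.mod_lt _ (by positivity))) this

end Return

end DeBruijn

/-! ### Configurations as walks -/

namespace LQCA

open scoped InnerProductSpace
open AlgRAM DeBruijn

variable {Q : Type*} [Fintype Q] (A : LQCA Q) (ε : Q ≃ Fin (Fintype.card Q))

/-- The neighborhood, shifted such that it starts at `0`. -/
def offset (j : ℕ) : ℕ :=
  if h : j < A.r then (A.nbr ⟨j, h⟩ - A.nbr ⟨0, A.one_le_r⟩).toNat else 0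

/-- The last element of the shifted neighborhood. -/
def width : ℕ := A.offset (A.r - 1)

theorem offset_eq {j : ℕ} (h : j < A.r) :
    (A.offset j : ℤ) = A.nbr ⟨j, h⟩ - A.nbr ⟨0, A.one_le_r⟩ := by
  rw [offset, dif_pos h, Int.toNat_of_nonneg]
  exact sub_nonneg.2 (A.nbr_strictMono.monotone (Nat.zero_le j))

theorem offset_lt {i j : ℕ} (hij : i < j) (hj : j < A.r) : A.offset i < A.offset j := by
  have h := A.nbr_strictMono (a := ⟨i, hij.trans hj⟩) (b := ⟨j, hj⟩) hij
  have h1 := A.offset_eq (hij.trans hj)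
  have h2 := A.offset_eq hj
  omega

theorem offset_le {j : ℕ} (hj : j < A.r) : A.offset j ≤ A.width := by
  rcases Nat.lt_or_ge j (A.r - 1) with h | h
  · exact (A.offset_lt h (by omega)).le
  · rw [width, show A.r - 1 = j by omega]

theorem span_eq : A.span = A.width + 1 := by
  have := A.one_le_r
  rw [span, width, A.offset_eq (by omega)]

/-- The number whose digits are the states of the cells `i, …, i + n`. -/
def code (n : ℕ) (c : ℤ → Q) (i : ℤ) : ℕ :=
  ∑ j ∈ Finset.range (n + 1), (ε (c (i + j)) : ℕ) * Fintype.card Q ^ j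

theorem code_lt (n : ℕ) (c : ℤ → Q) (i : ℤ) : code ε n c i < Fintype.card Q ^ (n + 1) := by
  induction n with
  | zero => simp [code]
  | succ n ih =>
    rw [code, Finset.sum_range_succ, pow_succ _ (n + 1), mul_comm (_ ^ (n + 1)), add_comm]
    rw [mul_comm (Fintype.card Q)]
    have h1 := (ε (c (i + (n + 1 : ℕ)))).2
    calc _ < (ε (c (i + (n + 1 : ℕ))) : ℕ) * Fintype.card Q ^ (n + 1) + Fintype.card Q ^ (n + 1) :=
          Nat.add_lt_add_left ih _
      _ = (ε (c (i + (n + 1 : ℕ))) + 1) * Fintype.card Q ^ (n + 1) := by ring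
      _ ≤ Fintype.card Q * Fintype.card Q ^ (n + 1) := Nat.mul_le_mul_right _ h1
      _ = _ := mul_comm _ _

theorem code_succ (n : ℕ) (c : ℤ → Q) (i : ℤ) :
    code ε (n + 1) c i = code ε n c (i + 1) * Fintype.card Q + ε (c i) := by
  rw [code, Finset.sum_range_succ', code, Finset.sum_mul]
  simp [pow_succ, mul_assoc, add_comm, add_left_comm]

/-- Moving the block one cell to the left drops the leading digit and appends a trailing one, which
is `edge` after `red`. Walks therefore read configurations from right to left. -/
theorem code_eq (n : ℕ) (c : ℤ → Q) (i : ℤ) :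
    code ε n c i = code ε n c (i + 1) % Fintype.card Q ^ n * Fintype.card Q + ε (c i) := by
  cases n with
  | zero => simp [code, Nat.mod_one]
  | succ n =>
    rw [code_succ]
    have : code ε (n + 1) c (i + 1) = code ε n c (i + 1) +
        ε (c (i + 1 + (n + 1 : ℕ))) * Fintype.card Q ^ (n + 1) := by
      rw [code, Finset.sum_range_succ, code]
    rw [this, Nat.add_mul_mod_self_right, Nat.mod_eq_of_lt (code_lt ε n c _)]

theorem digit_code {n o : ℕ} (ho : o ≤ n) (c : ℤ → Q) (i : ℤ) :
    digit (Fintype.card Q) o (code ε n c i) = ε (c (i + o)) := by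
  have hpos : 0 < Fintype.card Q := (ε (c i)).pos
  induction o generalizing n i with
  | zero =>
    rw [code_eq, digit, pow_zero, Nat.div_one, Nat.mul_add_mod_self_right]
    simpa using Nat.mod_eq_of_lt (ε (c i)).2
  | succ o ih =>
    obtain ⟨m, rfl⟩ : ∃ m, n = m + 1 := ⟨n - 1, by omega⟩
    rw [code_succ, digit, pow_succ', ← Nat.div_div_eq_div_mul, mul_comm,
      Nat.mul_add_div hpos, Nat.div_eq_of_lt (ε (c i)).2, add_zero]
    have := ih (n := m) (by omega) (i + 1)
    rw [digit] at this
    rw [this]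
    congr 3
    push_cast; ring

theorem code_congr {n : ℕ} {c c' : ℤ → Q} {i i' : ℤ} (h : ∀ j ≤ n, c (i + j) = c' (i' + j)) :
    code ε n c i = code ε n c' i' :=
  Finset.sum_congr rfl fun j hj => by rw [h j (by simpa [Nat.lt_succ_iff] using hj)]

/-- The argument of the local transition function that is coded by a number. -/
def word (x : ℕ) : Fin A.r → Q := fun j =>
  ε.symm ⟨digit (Fintype.card Q) (A.offset j) x, Nat.mod_lt _ (ε A.q).pos⟩

/-- The inner products of the values of the local transition function. -/
noncomputable def gram (x y : ℕ) : ℂ := ⟪A.δ (A.word ε x), A.δ (A.word ε y)⟫_ℂ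

variable {A}

theorem gram_self_ne_zero (x : ℕ) : A.gram ε x x ≠ 0 := by
  rw [gram, inner_self_ne_zero]
  exact norm_pos_iff.1 (A.δ_norm_pos _)

/-- The block starts at the first neighbor of the cell `i`, so neighbor `j` is the digit at its
offset. Digits in the gaps of the neighborhood do not matter. -/
theorem word_code (c : A.Config) (i : ℤ) :
    A.word ε (code ε A.width c.1 (i + A.nbr ⟨0, A.one_le_r⟩)) = A.window c i := by
  funext j
  simp only [word, window]
  rw [Equiv.symm_apply_eq, Fin.ext_iff]
  dsimp only
  rw [digit_code ε (A.offset_le j.2), A.offset_eq j.2, add_add_sub_cancel]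

theorem finprod_window (c c' : A.Config) :
    ∏ᶠ i, ⟪A.δ (A.window c i), A.δ (A.window c' i)⟫_ℂ =
      ∏ᶠ i, A.gram ε (code ε A.width c.1 i) (code ε A.width c'.1 i) := by
  rw [← finprod_comp_equiv (Equiv.addRight (A.nbr ⟨0, A.one_le_r⟩))
    (f := fun i => A.gram ε (code ε A.width c.1 i) (code ε A.width c'.1 i))]
  simp [gram, word_code]

variable (A) in
/-- The code of the word of quiescent states. -/
def quiescentCode : ℕ := code ε A.width (fun _ => A.q) 0

theorem gram_quiescentCode : A.gram ε (A.quiescentCode ε) (A.quiescentCode ε) = 1 := by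
  have : A.word ε (A.quiescentCode ε) = fun _ => A.q := by
    funext j
    simp only [word]
    rw [Equiv.symm_apply_eq, Fin.ext_iff]
    exact digit_code ε (A.offset_le j.2) _ _
  rw [gram, this, PiLp.inner_apply, Finset.sum_eq_single A.q]
  · simp [A.δ_quiescent_self]
  · intro y _ hy
    simp [A.δ_quiescent_ne y hy]
  · simp

theorem code_eq_quiescentCode {c : ℤ → Q} {i : ℤ} (h : ∀ j : ℕ, j ≤ A.width → c (i + j) = A.q) :
    code ε A.width c i = A.quiescentCode ε := code_congr ε h

/-- The pairs of states of two configurations in the cells `N, N - 1, …, N - (m - 1)`. -/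
def letters (N : ℤ) (c c' : ℤ → Q) (m : ℕ) : List (Fin (Fintype.card Q) × Fin (Fintype.card Q)) :=
  (List.range m).map fun t : ℕ => (ε (c (N - t)), ε (c' (N - t)))

/-- Right of `N` all blocks are quiescent, which gives the starting vertex; each letter then moves
the block one cell to the left. -/
theorem letters_walk {N : ℤ} {c c' : ℤ → Q} (hc : ∀ i, N < i → c i = A.q)
    (hc' : ∀ i, N < i → c' i = A.q) (m : ℕ) :
    endpoint (Fintype.card Q ^ A.width) (red (Fintype.card Q ^ A.width)
        (A.quiescentCode ε, A.quiescentCode ε)) (letters ε N c c' m) =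
      red (Fintype.card Q ^ A.width)
        (code ε A.width c (N - m + 1), code ε A.width c' (N - m + 1)) ∧
    weight (Fintype.card Q ^ A.width) (A.gram ε) (red (Fintype.card Q ^ A.width)
        (A.quiescentCode ε, A.quiescentCode ε)) (letters ε N c c' m) =
      ∏ t ∈ Finset.range m,
        A.gram ε (code ε A.width c (N - t)) (code ε A.width c' (N - t)) := by
  induction m with
  | zero =>
    rw [code_eq_quiescentCode ε (c := c) fun j _ => hc _ (by omega),
      code_eq_quiescentCode ε (c := c') fun j _ => hc' _ (by omega)]
    simp [letters, endpoint, weight]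
  | succ m ih =>
    have hl : letters ε N c c' (m + 1) =
        letters ε N c c' m ++ [(ε (c (N - m)), ε (c' (N - m)))] := by
      simp [letters, List.range_succ]
    have he : edge (red (Fintype.card Q ^ A.width)
        (code ε A.width c (N - m + 1), code ε A.width c' (N - m + 1)))
        (ε (c (N - m)), ε (c' (N - m))) =
        (code ε A.width c (N - m), code ε A.width c' (N - m)) := by
      rw [code_eq ε _ c (N - m), code_eq ε _ c' (N - m)]
      rfl
    rw [hl, endpoint_concat, weight_concat, ih.1, ih.2, he, Finset.prod_range_succ]
    refine ⟨?_, rfl⟩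
    rw [show N - ((m + 1 : ℕ) : ℤ) + 1 = N - m by push_cast; ring]

theorem finprod_eq_weight {N : ℤ} {c c' : ℤ → Q} (hc : ∀ i, N < i → c i = A.q)
    (hc' : ∀ i, N < i → c' i = A.q) {m : ℕ}
    (hm : ∀ i ≤ N - m, code ε A.width c i = A.quiescentCode ε)
    (hm' : ∀ i ≤ N - m, code ε A.width c' i = A.quiescentCode ε) :
    ∏ᶠ i, A.gram ε (code ε A.width c i) (code ε A.width c' i) =
      weight (Fintype.card Q ^ A.width) (A.gram ε) (red (Fintype.card Q ^ A.width)
        (A.quiescentCode ε, A.quiescentCode ε)) (letters ε N c c' m) := by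
  rw [(letters_walk ε hc hc' m).2, ← Finset.prod_image
    (s := Finset.range m) (g := fun t : ℕ => N - (t : ℤ)) (f := fun i =>
    A.gram ε (code ε A.width c i) (code ε A.width c' i)) (fun a _ b _ h => by simpa using h)]
  refine finprod_eq_prod_of_mulSupport_subset _ fun i hi => ?_
  by_contra h
  refine hi ?_
  simp only [Finset.coe_image, Finset.coe_range, Set.mem_image, Set.mem_Iio, not_exists,
    not_and] at h
  change A.gram ε (code ε A.width c i) (code ε A.width c' i) = 1
  rcases lt_or_ge N i with hi | hi
  · rw [code_eq_quiescentCode ε (c := c) fun j _ => hc _ (by omega),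
      code_eq_quiescentCode ε (c := c') fun j _ => hc' _ (by omega), gram_quiescentCode]
  · have : ¬ (N - i).toNat < m := fun h' => h _ h' (by omega)
    rw [hm i (by omega), hm' i (by omega), gram_quiescentCode]

theorem exists_walk_of_config (c c' : A.Config) :
    ∃ l : List (Fin (Fintype.card Q) × Fin (Fintype.card Q)),
      endpoint (Fintype.card Q ^ A.width) (red (Fintype.card Q ^ A.width)
        (A.quiescentCode ε, A.quiescentCode ε)) l =
        red (Fintype.card Q ^ A.width) (A.quiescentCode ε, A.quiescentCode ε) ∧
      ∏ᶠ i, A.gram ε (code ε A.width c.1 i) (code ε A.width c'.1 i) =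
        weight (Fintype.card Q ^ A.width) (A.gram ε) (red (Fintype.card Q ^ A.width)
          (A.quiescentCode ε, A.quiescentCode ε)) l ∧
      (IsDiag l ↔ c = c') := by
  obtain ⟨N, hN⟩ : ∃ N : ℕ, ∀ i : ℤ, (N < i ∨ i < -N) → c.1 i = A.q ∧ c'.1 i = A.q := by
    obtain ⟨b, hb⟩ := (c.2.union c'.2).bddAbove
    obtain ⟨a, ha⟩ := (c.2.union c'.2).bddBelow
    refine ⟨(max b (-a)).toNat, fun i hi => ?_⟩
    by_contra h
    have hmem : i ∈ {i | c.1 i ≠ A.q} ∪ {i | c'.1 i ≠ A.q} := by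
      by_contra h'
      exact h (by simpa [not_or] using h')
    have h1 := hb hmem
    have h2 := ha hmem
    omega
  have hc : ∀ i, (N : ℤ) < i → c.1 i = A.q := fun i hi => (hN i (.inl hi)).1
  have hc' : ∀ i, (N : ℤ) < i → c'.1 i = A.q := fun i hi => (hN i (.inl hi)).2
  -- With `2 * N + A.width + 2` letters the last cell of the block at `N - m + 1` is `-N - 1`, just
  -- beyond the nonquiescent cells.
  have hm : ∀ i ≤ (N : ℤ) - (2 * N + A.width + 2 : ℕ) + 1,
      code ε A.width c.1 i = A.quiescentCode ε ∧ code ε A.width c'.1 i = A.quiescentCode ε :=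
    fun i hi => ⟨code_eq_quiescentCode ε fun j hj => (hN _ (.inr (by push_cast at hi; omega))).1,
      code_eq_quiescentCode ε fun j hj => (hN _ (.inr (by push_cast at hi; omega))).2⟩
  refine ⟨letters ε N c.1 c'.1 (2 * N + A.width + 2), ?_, ?_, ?_⟩
  · rw [(letters_walk ε hc hc' _).1, (hm _ le_rfl).1, (hm _ le_rfl).2]
  · exact finprod_eq_weight ε hc hc' (fun i hi => (hm i (by omega)).1)
      fun i hi => (hm i (by omega)).2
  · constructor
    · intro h
      refine Subtype.ext (funext fun i => ?_)
      by_cases hi : (N : ℤ) < i ∨ i < -N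
      · rw [(hN i hi).1, (hN i hi).2]
      · have ht : ((N : ℤ) - i).toNat < 2 * N + A.width + 2 := by omega
        have := h (ε (c.1 (N - ((N - i).toNat : ℕ))), ε (c'.1 (N - ((N - i).toNat : ℕ))))
          (List.mem_map.2 ⟨_, List.mem_range.2 ht, rfl⟩)
        rw [show (N : ℤ) - ((N - i).toNat : ℕ) = i by omega] at this
        exact ε.injective this
    · rintro rfl a ha
      obtain ⟨t, -, rfl⟩ := List.mem_map.1 ha
      rfl

theorem exists_config_of_walk (l : List (Fin (Fintype.card Q) × Fin (Fintype.card Q)))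
    (hl : endpoint (Fintype.card Q ^ A.width) (red (Fintype.card Q ^ A.width)
        (A.quiescentCode ε, A.quiescentCode ε)) l =
        red (Fintype.card Q ^ A.width) (A.quiescentCode ε, A.quiescentCode ε)) :
    ∃ c c' : A.Config,
      ∏ᶠ i, A.gram ε (code ε A.width c.1 i) (code ε A.width c'.1 i) =
        weight (Fintype.card Q ^ A.width) (A.gram ε) (red (Fintype.card Q ^ A.width)
          (A.quiescentCode ε, A.quiescentCode ε)) l ∧
      (IsDiag l ↔ c = c') := by
  let f : (Fin (Fintype.card Q) × Fin (Fintype.card Q) → Q) → ℤ → Q := fun π i =>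
    if i ≤ 0 then ((l[(-i).toNat]?).map π).getD A.q else A.q
  have hfar : ∀ π i, (0 < i ∨ i ≤ -(l.length : ℤ)) → f π i = A.q := by
    rintro π i (hi | hi)
    · simp [f, hi]
    · have : l[(-i).toNat]? = none := List.getElem?_eq_none (by omega)
      simp [f, this]
  have hget : ∀ π t (ht : t < l.length), f π (0 - t) = π l[t] := by
    intro π t ht
    simp [f, ht]
  have hfin : ∀ π, {i : ℤ | f π i ≠ A.q}.Finite := fun π =>
    (Set.finite_Icc (-(l.length : ℤ)) 0).subset fun i hi => by
      by_contra h
      refine hi (hfar π i ?_)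
      simp only [Set.mem_Icc, not_and_or] at h
      omega
  set c : A.Config := ⟨f fun a => ε.symm a.1, hfin _⟩ with hcdef
  set c' : A.Config := ⟨f fun a => ε.symm a.2, hfin _⟩ with hcdef'
  have hc : ∀ i, 0 < i → c.1 i = A.q := fun i hi => hfar _ i (.inl hi)
  have hc' : ∀ i, 0 < i → c'.1 i = A.q := fun i hi => hfar _ i (.inl hi)
  have hletters : letters ε 0 c.1 c'.1 l.length = l := by
    refine List.ext_getElem (by simp [letters]) fun t h1 h2 => ?_
    simp only [letters, List.getElem_map, List.getElem_range, c, c', hget _ t h2,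
      Equiv.apply_symm_apply]
  have hend := (letters_walk ε hc hc' l.length).1
  rw [hletters, hl] at hend
  -- As the walk is closed, the block at its left end is quiescent up to the leading digit, which
  -- `code_eq` drops; from there on only quiescent states are appended.
  have hquiet : ∀ d : ℤ → Q, (∀ i ≤ -(l.length : ℤ), d i = A.q) →
      A.quiescentCode ε % Fintype.card Q ^ A.width =
        code ε A.width d (0 - l.length + 1) % Fintype.card Q ^ A.width →
      ∀ i ≤ 0 - (l.length : ℤ), code ε A.width d i = A.quiescentCode ε := by
    intro d hd h0
    have hq : A.quiescentCode ε =
        A.quiescentCode ε % Fintype.card Q ^ A.width * Fintype.card Q + ε A.q :=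
      (code_eq ε A.width (fun _ => A.q) 0).trans (by
        rw [code_congr ε (i' := 0) (c' := fun _ => A.q) fun _ _ => rfl]; rfl)
    have key : ∀ t : ℕ, code ε A.width d (0 - l.length - t) = A.quiescentCode ε := by
      intro t
      induction t with
      | zero => rw [code_eq, Nat.cast_zero, sub_zero, ← h0, hd _ (by omega), ← hq]
      | succ t ih =>
        rw [code_eq, hd _ (by push_cast; omega),
          show (0 : ℤ) - l.length - (t + 1 : ℕ) + 1 = 0 - l.length - t by push_cast; ring, ih, ← hq]
    intro i hi
    have := key (0 - l.length - i).toNat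
    rwa [show (0 : ℤ) - l.length - ((0 - l.length - i).toNat : ℕ) = i by omega] at this
  refine ⟨c, c', ?_, ?_⟩
  · rw [finprod_eq_weight ε hc hc' (m := l.length)
      (hquiet _ (fun i hi => hfar _ i (.inr hi)) (congrArg Prod.fst hend))
      (hquiet _ (fun i hi => hfar _ i (.inr hi)) (congrArg Prod.snd hend)), hletters]
  · constructor
    · intro h
      refine Subtype.ext (funext fun i => ?_)
      by_cases hi : 0 < i ∨ i ≤ -(l.length : ℤ)
      · exact (hfar _ i hi).trans (hfar _ i hi).symm
      · have ht : (-i).toNat < l.length := by omega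
        have h1 := hget (fun a => ε.symm a.1) _ ht
        have h2 := hget (fun a => ε.symm a.2) _ ht
        rw [show (0 : ℤ) - ((-i).toNat : ℕ) = i by omega] at h1 h2
        change f _ i = f _ i
        rw [h1, h2, h _ (List.getElem_mem ht)]
    · intro h a ha
      obtain ⟨t, ht, rfl⟩ := List.getElem_of_mem ha
      have h1 := hget (fun a => ε.symm a.1) _ ht
      have h2 := hget (fun a => ε.symm a.2) _ ht
      have h3 : c.1 (0 - t) = c'.1 (0 - t) := by rw [h]
      exact ε.symm.injective (h1.symm.trans (h3.trans h2))

theorem wellFormed_iff (hQ : 2 ≤ Fintype.card Q) : A.WellFormed ↔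
    IsPotential (Fintype.card Q) (Fintype.card Q ^ A.width)
      (Fintype.card Q ^ A.width * Fintype.card Q) (fun x => A.gram ε x x) ∧
    NoReturn (Fintype.card Q) (Fintype.card Q ^ A.width) (A.gram ε) := by
  have hz : A.quiescentCode ε % Fintype.card Q ^ A.width < Fintype.card Q ^ A.width :=
    Nat.mod_lt _ (by positivity)
  rw [isPotential_iff hQ (fun x _ => gram_self_ne_zero ε x) hz,
    noReturn_iff hQ (fun x _ => gram_self_ne_zero ε x) hz, wellFormed_iff_inner]
  simp only [finprod_window ε]
  constructor
  · rintro ⟨h1, h2⟩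
    refine ⟨fun l hl he => ?_, fun l hl he => ?_⟩
    · obtain ⟨c, c', hw, hd⟩ := exists_config_of_walk ε l he
      obtain rfl := hd.1 hl
      exact hw.symm.trans (h1 c)
    · obtain ⟨c, c', hw, hd⟩ := exists_config_of_walk ε l he
      exact hw.symm.trans (h2 c c' (hd.not.1 hl))
  · rintro ⟨h1, h2⟩
    refine ⟨fun c => ?_, fun c c' hc => ?_⟩
    · obtain ⟨l, he, hw, hd⟩ := exists_walk_of_config ε c c
      exact hw.trans (h1 l (hd.2 rfl) he)
    · obtain ⟨l, he, hw, hd⟩ := exists_walk_of_config ε c c'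
      exact hw.trans (h2 l (hd.not.2 hc) he)

/-- With a single state the size is 1, so only constant time is allowed, whereas the tables take
time that grows with the span. The program answers this case at once. -/
theorem wellFormed_of_card_eq_one (hQ : Fintype.card Q = 1) : A.WellFormed := by
  have : Subsingleton Q := Fintype.card_le_one_iff_subsingleton.1 hQ.le
  have hc : ∀ c c' : A.Config, c = c' := fun c c' => Subtype.ext (Subsingleton.elim _ _)
  rw [wellFormed_iff_inner]
  refine ⟨fun c => ?_, fun c c' h => absurd (hc c c') h⟩
  refine finprod_eq_one_of_forall_eq_one fun i => ?_
  rw [Subsingleton.elim (A.window c i) fun _ => A.q, PiLp.inner_apply,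
    Finset.sum_eq_single A.q (fun y _ hy => absurd (Subsingleton.elim _ _) hy) (by simp)]
  simp [A.δ_quiescent_self]

end LQCA

/-! ### The input in memory -/

namespace LQCA

open scoped InnerProductSpace
open AlgRAM DeBruijn

variable {Q : Type*} [Fintype Q] (A : LQCA Q) (ε : Q ≃ Fin (Fintype.card Q))

theorem address_injective {w w' : Fin A.r → Q} {y y' : Q}
    (h : A.address ε w y = A.address ε w' y') : w = w' ∧ y = y' := by
  have hpos : 0 < Fintype.card Q := (ε y).pos
  have e : ∀ (w : Fin A.r → Q), (∑ j : Fin A.r, (ε (w j) : ℕ) * Fintype.card Q ^ (j : ℕ)) =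
      (finFunctionFinEquiv fun j => ε (w j) : ℕ) := fun w => (finFunctionFinEquiv_apply _).symm
  rw [address, address, e, e] at h
  have h1 := congrArg (· / Fintype.card Q) h
  have h2 := congrArg (· % Fintype.card Q) h
  simp only [mul_comm _ (Fintype.card Q), Nat.mul_add_div hpos, Nat.mul_add_mod,
    Nat.div_eq_of_lt (ε y).2, Nat.div_eq_of_lt (ε y').2, Nat.mod_eq_of_lt (ε y).2,
    Nat.mod_eq_of_lt (ε y').2, add_zero] at h1 h2
  have h3 := finFunctionFinEquiv.injective (Fin.ext h1)
  exact ⟨funext fun j => ε.injective (congrFun h3 j), ε.injective (Fin.ext h2)⟩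

theorem input_carr_address (w : Fin A.r → Q) (y : Q) :
    (A.input ε).carr 0 (A.address ε w y : ℕ) = A.δ w y := by
  simp only [input, if_true]
  rw [Finset.sum_eq_single w, Finset.sum_eq_single y]
  · simp
  · intro y' _ hy
    rw [if_neg]
    intro h
    exact hy (A.address_injective ε (Nat.cast_injective h)).2.symm
  · simp
  · intro w' _ hw
    refine Finset.sum_eq_zero fun y' _ => ?_
    rw [if_neg]
    intro h
    exact hw (A.address_injective ε (Nat.cast_injective h)).1.symm
  · simp

theorem input_iarr {j : ℕ} (hj : j < A.r) : (A.input ε).iarr 0 j = A.nbr ⟨j, hj⟩ := by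
  simp only [input, if_true]
  rw [Finset.sum_eq_single ⟨j, hj⟩]
  · simp
  · intro i _ hi
    rw [if_neg]
    intro h
    exact hi (Fin.ext (by exact_mod_cast h.symm))
  · simp

theorem rowAddress_add (x z : ℕ) (hz : z < Fintype.card Q) :
    rowAddress (Fintype.card Q) A.r A.offset x + z =
      A.address ε (A.word ε x) (ε.symm ⟨z, hz⟩) := by
  simp [rowAddress, address, Finset.sum_range, Finset.sum_mul, word, pow_succ, mul_assoc]

theorem gram_eq_sum (x y : ℕ) : A.gram ε x y = ∑ z ∈ Finset.range (Fintype.card Q),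
    star ((A.input ε).carr 0 (rowAddress (Fintype.card Q) A.r A.offset x + z : ℕ)) *
      (A.input ε).carr 0 (rowAddress (Fintype.card Q) A.r A.offset y + z : ℕ) := by
  rw [gram, PiLp.inner_apply, Finset.sum_range, ← ε.symm.sum_comp]
  refine Finset.sum_congr rfl fun z _ => ?_
  rw [A.rowAddress_add ε x z z.2, A.rowAddress_add ε y z z.2, input_carr_address,
    input_carr_address]
  simp [mul_comm]

/-- The graph of pairs of words, the pair `(x, y)` being numbered by `x * M + y`. -/
noncomputable def pairGraph : SearchGraph where
  k := Fintype.card Q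
  M := Fintype.card Q ^ A.width * Fintype.card Q
  N := (Fintype.card Q ^ A.width * Fintype.card Q) * (Fintype.card Q ^ A.width * Fintype.card Q)
  base i := (i / (Fintype.card Q ^ A.width * Fintype.card Q) % Fintype.card Q ^ A.width *
      (Fintype.card Q ^ A.width * Fintype.card Q) +
    i % (Fintype.card Q ^ A.width * Fintype.card Q) % Fintype.card Q ^ A.width) * Fintype.card Q
  diag i := i / (Fintype.card Q ^ A.width * Fintype.card Q) =
    i % (Fintype.card Q ^ A.width * Fintype.card Q)
  live i := A.gram ε (i / (Fintype.card Q ^ A.width * Fintype.card Q))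
    (i % (Fintype.card Q ^ A.width * Fintype.card Q)) ≠ 0

/-- The pair of words with a given number. -/
def pairOf (i : ℕ) : ℕ × ℕ := (i / (Fintype.card Q ^ A.width * Fintype.card Q),
  i % (Fintype.card Q ^ A.width * Fintype.card Q))

/-- `(x % K * M + y % K) * k + (b * M + c)` regroups as `(x % K * k + b) * M + (y % K * k + c)`,
where both brackets are below `M`. -/
theorem pairGraph_succ (i : ℕ) (a : Fin (Fintype.card Q) × Fin (Fintype.card Q)) :
    A.pairOf ((A.pairGraph ε).succ i a.1 a.2) =
      edge (red (Fintype.card Q ^ A.width) (A.pairOf i)) a ∧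
    (A.pairGraph ε).succ i a.1 a.2 < (A.pairGraph ε).N := by
  have hpos : 0 < Fintype.card Q := a.1.pos
  set K := Fintype.card Q ^ A.width with hK
  have hKpos : 0 < K := by positivity
  set M := K * Fintype.card Q with hM
  set x := i / M % K * Fintype.card Q + a.1 with hx
  set y := i % M % K * Fintype.card Q + a.2 with hy
  have hxM : x < M := edge_fst_lt (Nat.mod_lt _ hKpos) a.1.2
  have hyM : y < M := edge_fst_lt (Nat.mod_lt _ hKpos) a.2.2
  have e : (A.pairGraph ε).succ i a.1 a.2 = M * x + y := by
    simp only [SearchGraph.succ, pairGraph, ← hK, ← hM, hx, hy]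
    ring
  rw [e]
  constructor
  · simp only [pairOf, ← hK, ← hM, edge, red]
    rw [Nat.mul_add_div (by omega), Nat.mul_add_mod, Nat.div_eq_of_lt hyM, Nat.mod_eq_of_lt hyM,
      add_zero]
  · change M * x + y < M * M
    calc M * x + y < M * x + M := by omega
      _ = M * (x + 1) := by ring
      _ ≤ M * M := Nat.mul_le_mul_left _ hxM

theorem reach_imp {i : ℕ} (h : (A.pairGraph ε).Reach i) :
    PairReach (Fintype.card Q) (Fintype.card Q ^ A.width) (A.gram ε) (A.pairOf i) := by
  induction h with
  | refl =>
    rw [show A.pairOf 0 = (0, 0) by simp [pairOf]]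
    exact .refl
  | tail _ h ih =>
    obtain ⟨b, hb, c, hc, rfl, hl⟩ := h
    exact ih.tail ⟨(⟨b, hb⟩, ⟨c, hc⟩), (A.pairGraph_succ ε _ (⟨b, hb⟩, ⟨c, hc⟩)).1, hl⟩

theorem exists_reach {p : ℕ × ℕ}
    (h : PairReach (Fintype.card Q) (Fintype.card Q ^ A.width) (A.gram ε) p) :
    ∃ i, (A.pairGraph ε).Reach i ∧ A.pairOf i = p := by
  induction h with
  | refl => exact ⟨0, .refl, by simp [pairOf]⟩
  | tail _ h ih =>
    obtain ⟨a, rfl, hl⟩ := h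
    obtain ⟨i, hi, rfl⟩ := ih
    rw [← (A.pairGraph_succ ε i a).1] at hl ⊢
    exact ⟨_, hi.tail ⟨a.1, a.1.2, a.2, a.2.2, rfl, hl⟩, rfl⟩

theorem noReturn_pairGraph : (A.pairGraph ε).NoReturn ↔
    NoReturn (Fintype.card Q) (Fintype.card Q ^ A.width) (A.gram ε) := by
  constructor
  · intro h p hp a
    obtain ⟨i, hi, rfl⟩ := A.exists_reach ε hp
    rw [← (A.pairGraph_succ ε i a).1]
    exact h i hi a.1 a.1.2 a.2 a.2.2
  · intro h i hi b hb c hc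
    have := h _ (A.reach_imp ε hi) (⟨b, hb⟩, ⟨c, hc⟩)
    rw [← (A.pairGraph_succ ε i (⟨b, hb⟩, ⟨c, hc⟩)).1] at this
    exact this

end LQCA

/-! ### The decision procedure -/

namespace AlgRAM

/-- Decides whether a linear quantum cellular automaton is well-formed. -/
def wellFormedProg : Prog :=
  .ite (.ieq (.reg 1) (.const 1)) (.setI 0 (.const 1))
    (.seq (.setI 0 (.const 1)) (.seq addressProg (.seq divModProg (.seq gramProg
      (.seq potentialProg SearchGraph.searchProg)))))

end AlgRAM

namespace LQCA

open AlgRAM DeBruijn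

variable {Q : Type*} [Fintype Q] (A : LQCA Q) (ε : Q ≃ Fin (Fintype.card Q))

theorem wellFormedProg_spec (hQ : 2 ≤ Fintype.card Q) :
    Does wellFormedProg (A.input ε)
      (1000 * (Fintype.card Q ^ (A.width + 1) * Fintype.card Q) ^ 2)
      fun σ => Flag σ A.WellFormed := by
  set K := Fintype.card Q ^ A.width with hK
  set M := K * Fintype.card Q with hM
  have hKpos : 0 < K := by positivity
  have hpow : Fintype.card Q ^ (A.width + 1) = M := pow_succ _ _
  have hMpos : 0 < M := by positivity
  have hwidth : A.width + 1 ≤ M := by rw [← hpow]; exact (Nat.lt_pow_self (by omega)).le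
  have hr := A.one_le_r
  have i0 : (A.input ε).ireg 1 = Fintype.card Q := by simp [input]
  refine Does.mono (T := 3 + max 2 (2 + (((A.width + 1) * (M * 17 + 66) + 100) + ((M * 50 + 7) +
    ((M * (M * (Fintype.card Q * 24 + 100) + 16) + 7) + ((M * 100 + 16) +
      (M * M * (Fintype.card Q * (Fintype.card Q * 69 + 16) + 30) + 20)))))))
    (Does.ite (fun h => ?_) fun _ => ?_) ?_ fun _ h => h
  · exfalso
    simp only [Cond.holds_ieq, IExpr.val, i0] at h
    omega
  · refine Does.seq_straight (T' := _) rfl le_rfl ?_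
    set σ₀ := (Prog.setI 0 (.const 1)).exec (A.input ε) with hσ₀
    have h1₀ : σ₀.ireg 1 = Fintype.card Q := by simp [hσ₀, Prog.exec, i0]
    have h2₀ : σ₀.ireg 2 = A.r := by simp [hσ₀, Prog.exec, input]
    have h0₀ : σ₀.ireg 0 = 1 := by simp [hσ₀, Prog.exec]
    have ha₀ : ∀ a, a ≠ 0 → ∀ i, σ₀.iarr a i = 0 := by
      intro a ha i; simp [hσ₀, Prog.exec, input, ha]
    have hn₀ : ∀ j < A.r, σ₀.iarr 0 j - σ₀.iarr 0 0 = A.offset j := by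
      intro j hj
      rw [A.offset_eq hj, ← A.input_iarr ε hj, ← A.input_iarr ε (show 0 < A.r by omega)]
      rfl
    have hc₀ : σ₀.carr = (A.input ε).carr := rfl
    clear_value σ₀
    refine Does.seq_then (Does.frame (addressProg_spec (o := A.offset) (by omega) hr h1₀ h2₀
      (fun i j hij hj => A.offset_lt hij hj) hn₀ (ha₀ 1 (by decide) 0)))
      (by rw [← width, hpow]) ?_
    rintro σ₁ ⟨hf₁, h6₁, h9₁, hT₁⟩
    rw [← width] at h6₁ h9₁ hT₁
    rw [hpow] at hT₁
    replace h6₁ : σ₁.ireg 6 = M := by rw [h6₁, ← hpow]; push_cast; rfl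
    replace h9₁ : σ₁.ireg 9 = K := by rw [h9₁, hK]; push_cast; rfl
    have h1₁ := (hf₁.ireg 1 (by decide)).trans h1₀
    have h0₁ := (hf₁.ireg 0 (by decide)).trans h0₀
    have hc₁ : σ₁.carr 0 = (A.input ε).carr 0 := (hf₁.carr 0 (by decide)).trans (by rw [hc₀])
    refine Does.seq_then (Does.frame (divModProg_spec (by omega) hKpos h1₁ h9₁ h6₁)) le_rfl ?_
    rintro σ₂ ⟨hf₂, hdm⟩
    have h6₂ := (hf₂.ireg 6 (by decide)).trans h6₁
    have h9₂ := (hf₂.ireg 9 (by decide)).trans h9₁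
    have h1₂ := (hf₂.ireg 1 (by decide)).trans h1₁
    have h0₂ := (hf₂.ireg 0 (by decide)).trans h0₁
    have hT₂ : ∀ x < M, σ₂.iarr 1 x = rowAddress (Fintype.card Q) A.r A.offset x := fun x hx =>
      (congrFun (hf₂.iarr 1 (by decide)) _).trans (hT₁ x hx)
    have hc₂ : σ₂.carr 0 = (A.input ε).carr 0 := (hf₂.carr 0 (by decide)).trans hc₁
    refine Does.seq_then (Does.frame (gramProg_spec (K := K) (g := A.gram ε) h1₂ h6₂ hT₂
      (fun x hx => (hdm x hx).2) fun x _ y _ => by rw [hc₂]; exact A.gram_eq_sum ε x y)) le_rfl ?_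
    rintro σ₃ ⟨hf₃, hgram⟩
    have h6₃ := (hf₃.ireg 6 (by decide)).trans h6₂
    have h9₃ := (hf₃.ireg 9 (by decide)).trans h9₂
    have h1₃ := (hf₃.ireg 1 (by decide)).trans h1₂
    have h0₃ := (hf₃.ireg 0 (by decide)).trans h0₂
    have hdiag : ∀ x < M, σ₃.carr 1 (x * (M + 1) : ℕ) = A.gram ε x x := by
      intro x hx
      have e : x * (M + 1) = M * x + x := by ring
      have hlt : x * (M + 1) < M * M := by
        calc x * (M + 1) < M * x + M := by rw [e]; omega
          _ = M * (x + 1) := by ring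
          _ ≤ M * M := Nat.mul_le_mul_left _ hx
      rw [(hgram _ hlt).gram, e, Nat.mul_add_div hMpos, Nat.mul_add_mod, Nat.div_eq_of_lt hx,
        Nat.mod_eq_of_lt hx, add_zero]
    refine Does.seq_then (Does.frame (potentialProg_spec (w := fun x => A.gram ε x x) hQ hKpos hM
      h0₃ h9₃ h6₃ (fun x hx => (congrFun (hf₃.iarr 2 (by decide)) _).trans (hdm x hx).1)
      (fun x hx => (congrFun (hf₃.iarr 3 (by decide)) _).trans (hdm x hx).2) hdiag)) le_rfl ?_
    rintro σ₄ ⟨hf₄, hflag⟩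
    have hG : (A.pairGraph ε).InMemory σ₄ := by
      refine ⟨(hf₄.ireg 1 (by decide)).trans h1₃, (hf₄.ireg 6 (by decide)).trans h6₃,
        fun i hi => ?_, fun i hi => ?_⟩
      · exact (congrFun (hf₄.iarr 4 (by decide)) _).trans (hgram i hi).base
      · rw [hf₄.iarr 5 (by decide), (hgram i hi).diag]
        by_cases h : i / M = i % M
        · rw [if_pos h]
          exact (if_pos h).symm
        · rw [if_neg h]
          exact (if_neg h).symm
    refine (SearchGraph.searchProg_spec hG (Nat.mul_pos hMpos hMpos)
      (fun i _ b hb c hc => (A.pairGraph_succ ε i (⟨b, hb⟩, ⟨c, hc⟩)).2) (fun i hi => ?_)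
      hflag).mono le_rfl ?_
    · rw [hf₄.iarr 6 (by decide), (hgram i hi).dead]
      exact ⟨fun h => if_neg h, fun h => if_pos (not_not.1 h)⟩
    · intro σ₅ h5
      refine h5.congr rfl ?_
      rw [A.noReturn_pairGraph, wellFormed_iff ε hQ]
  · rw [hpow]
    have hk1 : 1 ≤ Fintype.card Q := by omega
    -- Every term of the time is at most `(M * k) ^ 2`, by `width + 1 ≤ M` and `1 ≤ k`; the
    -- coefficients add up to less than 1000.
    have a1 : (A.width + 1) * M ≤ (M * Fintype.card Q) ^ 2 := by
      calc (A.width + 1) * M ≤ (M * 1) * (M * 1) := by rw [mul_one]; gcongr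
        _ ≤ (M * Fintype.card Q) * (M * Fintype.card Q) := by gcongr
        _ = _ := (sq _).symm
    have a2 : M ≤ (M * Fintype.card Q) ^ 2 := (Nat.le_mul_of_pos_left M (by omega)).trans a1
    have a3 : M * M * Fintype.card Q ≤ (M * Fintype.card Q) ^ 2 := by
      calc M * M * Fintype.card Q ≤ M * M * Fintype.card Q * Fintype.card Q :=
          Nat.le_mul_of_pos_right _ hk1
        _ = _ := by ring
    have a4 : M * M ≤ M * M * Fintype.card Q := Nat.le_mul_of_pos_right _ hk1
    have e1 : (A.width + 1) * (M * 17 + 66) = 17 * ((A.width + 1) * M) + 66 * (A.width + 1) := by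
      ring
    have e2 : M * (M * (Fintype.card Q * 24 + 100) + 16) =
        24 * (M * M * Fintype.card Q) + 100 * (M * M) + 16 * M := by ring
    have e3 : M * M * (Fintype.card Q * (Fintype.card Q * 69 + 16) + 30) =
        69 * (M * Fintype.card Q) ^ 2 + 16 * (M * M * Fintype.card Q) + 30 * (M * M) := by ring
    rw [e1, e2, e3]
    refine (Nat.add_le_add_left (max_le (c := 2 + (17 * ((A.width + 1) * M) + 66 * (A.width + 1) +
      100 + (M * 50 + 7 + (24 * (M * M * Fintype.card Q) + 100 * (M * M) + 16 * M + 7 +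
      (M * 100 + 16 + (69 * (M * Fintype.card Q) ^ 2 + 16 * (M * M * Fintype.card Q) +
      30 * (M * M) + 20)))))) (by omega) le_rfl) 3).trans ?_
    omega

/-- The exponent `r + 1` of the size cancels the denominator of the expansion factor, which leaves
k^(2(s+1)). -/
theorem size_rpow : (A.size : ℝ) ^ (2 * A.expansion) =
    ((Fintype.card Q ^ (A.width + 1) * Fintype.card Q) ^ 2 : ℕ) := by
  have hr : ((A.r : ℝ) + 1) ≠ 0 := by positivity
  have e : ((A.r + 1 : ℕ) : ℝ) * (2 * A.expansion) = ((A.width + 2) * 2 : ℕ) := by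
    rw [expansion, A.span_eq]
    push_cast
    field_simp
    ring
  rw [size, Nat.cast_pow, ← Real.rpow_natCast, ← Real.rpow_mul (by positivity), e,
    Real.rpow_natCast, ← pow_succ, ← pow_mul]
  push_cast
  rfl

end LQCA

/-- There are a program `P` and an absolute constant `C` such that `P`, given any LQCA `A` of size
`n` with expansion factor `e`, halts within time `C * n ^ (2 * e)` and leaves in integer register
`0` the value `1` if `A` is well-formed and `0` if it is not. -/
theorem corollary3 :
    ∃ (P : AlgRAM.Prog) (C : ℝ),
      ∀ (Q : Type*) [Fintype Q] (A : LQCA Q) (ε : Q ≃ Fin (Fintype.card Q)),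
        ∃ (t : ℕ) (σ : AlgRAM.State), AlgRAM.Runs P (A.input ε) t σ ∧
          (A.WellFormed → σ.ireg 0 = 1) ∧ (¬ A.WellFormed → σ.ireg 0 = 0) ∧
          (t : ℝ) ≤ C * (A.size : ℝ) ^ (2 * A.expansion) := by
  refine ⟨AlgRAM.wellFormedProg, 1000, fun Q _ A ε => ?_⟩
  rw [A.size_rpow]
  have hpos : 0 < Fintype.card Q := (ε A.q).pos
  rcases (show Fintype.card Q = 1 ∨ 2 ≤ Fintype.card Q by omega) with hQ | hQ
  · have hb : (AlgRAM.Cond.ieq (.reg 1) (.const 1)).Holds (A.input ε) := by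
      simp [LQCA.input, hQ]
    refine ⟨_, _, .ite_true hb (.setI _ _ _), fun _ => by simp,
      fun h => absurd (LQCA.wellFormed_of_card_eq_one hQ) h, ?_⟩
    rw [hQ]
    norm_num [AlgRAM.Cond.cost]
  · obtain ⟨t, σ, hrun, ht, h1, h0⟩ := A.wellFormedProg_spec ε hQ
    exact ⟨t, σ, hrun, h1, h0, by exact_mod_cast ht⟩
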